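/- All categories and groupoids are small. **Ordered groupoids.** An *ordered groupoid* is a groupoid $\mathcal G$ with a partial order on its arrows such that $a\le b$ implies $a^{-1}\le b^{-1}$; $a\le b$ and $c\le d$ imply $ac\le bd$ whenever both composites exist; and, writing $A'\le A$ for $1_{A'}\le 1_A$, for each $f\colon A\to B$ and each $A'\le A$ there is a unique arrow $f|_{A'}\le f$ with source $A'$. *Ordered functors* are order-preserving functors. For ordered functors $F,F'\colon\mathcal G\to\mathcal H$ write $F\le F'$ if $Fh\le F'h$ for all arrows $h$; a *horizontal transformation* $F\to F'$ is a natural transformation $\alpha$ with $\alpha_X\le\alpha_{Y}$ whenever $X\le Y$. Ordered functors and horizontal transformations form an ordered groupoid $[\mathcal G,\mathcal H]$, in which $\alpha\le\beta$ means that $\alpha_X\le\beta_X$ for all $X$, that the source of $\alpha$ is $\le$ the source of $\beta$, and likewise for the targets. **The construction $\mathbf L$.** For an ordered groupoid $\mathcal G$, the left-cancellative category $\mathbf L(\mathcal G)$ has the objects of $\mathcal G$; an arrow $A\to B$ is a pair $(h\colon A\to B',\,B'\le B)$, and the composite of $(h,B'\le B)$ and $(k\colon B\to C',\,C'\le C)$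 is $(k|_{B'}h\colon A\to C'',\,C''\le C)$, where $C''\le C'$ is the target of $k|_{B'}$. **The 2-categories.** $\mathbf{oGpd}$ is the 2-category of ordered groupoids, ordered functors and *$\Lambda$-transformations*, with hom-categories $\mathbf L([\mathcal G,\mathcal H])$; so a 2-cell $F\Rightarrow F'$ is a horizontal transformation $\alpha\colon F\to F''$ together with $F''\le F'$. $\mathbf{lcCat}$ is the 2-category of left-cancellative categories (all arrows are monomorphisms), functors and natural transformations. $\mathbf{oGpd}_{\max}\subseteq\mathbf{oGpd}$ is the full sub-2-category on the ordered groupoids in which each object lies below a unique maximal object. **The 2-functors.** $\mathbf L\colon\mathbf{oGpd}_{\max}\to\mathbf{lcCat}$ is given on objects as above, by $\mathbf L(F)(h,\le)=(Fh,\le)$ on 1-cells and $\mathbf L(\alpha,\le)_X=(\alpha_X,\le)$ on 2-cells. $\mathbf G\colon\mathbf{lcCat}\to\mathbf{oGpd}_{\max}$ sends $\mathcal C$ to the ordered groupoid whose objects are the subobjects $[m\colon A\to B]$ in $\mathcal C$ and whose arrows $[m]\to[n]$ are the isomorphism classes $[m,n]$ of spans $\bullet\xleftarrow{m}\bullet\xrightarrow{n}\bullet$,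 with $[m,n]\circ[k,m]=[k,n]$, and with $[m,n]\le[m',n']$ if $m=m'h$ and $n=n'h$ for some $h$; it is given by $[m,n]\mapsto[Km,Kn]$ on functors $K$, and sends $\theta\colon K\Rightarrow K'$ to the $\Lambda$-transformation with components $[Km]\xrightarrow{[Km,\,K'm\circ\theta_{\mathrm{dom}(m)}]}[K'm\circ\theta_{\mathrm{dom}(m)}]\le[K'm]$. **Theorem.** $\mathbf L$ and $\mathbf G$ define a 2-adjoint biequivalence $\mathbf{oGpd}_{\max}\simeq\mathbf{lcCat}$. That is, the functors $$\eta_{\mathcal C}\colon\mathcal C\to\mathbf{LG}(\mathcal C),\qquad A\mapsto[1_A],\qquad (f\colon A\to B)\mapsto\big([1_A]\xrightarrow{[1_A,f]}[f]\le[1_B]\big),$$ and the ordered functors $$\kappa_{\mathcal G}\colon\mathbf{GL}(\mathcal G)\to\mathcal G,\qquad [(h\colon A\to B',\,B'\le B)]\mapsto B',\qquad [(h,\le),(k,\le)]\mapsto kh^{-1},$$ are the components of strictly 2-natural transformations $\eta\colon 1\Rightarrow\mathbf{LG}$ and $\kappa\colon\mathbf{GL}\Rightarrow 1$; these satisfy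 the triangle identities $\kappa_{\mathbf G\mathcal C}\circ\mathbf G(\eta_{\mathcal C})=1$ and $\mathbf L(\kappa_{\mathcal G})\circ\eta_{\mathbf L\mathcal G}=1$ strictly; and every $\eta_{\mathcal C}$ is an equivalence in the 2-category $\mathbf{lcCat}$ and every $\kappa_{\mathcal G}$ is an equivalence in the 2-category $\mathbf{oGpd}_{\max}$ (that is, each has a pseudo-inverse). -/

import Mathlib

open CategoryTheory

universe u

/-- An ordered groupoid: a (small) groupoid with a partial order on its arrows, compatible with
inverses and composition, such that every arrow has a unique restriction to every object below its
source. The order on objects is the one between identity arrows.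

Seen as a double category, the horizontal arrows are those of the groupoid, there is a vertical arrow
from `A` to `A'` exactly when `A ≤ A'`, and a double cell from `f` to `f'` exactly when `f ≤ f'`. -/
class OrderedGroupoid (G : Type u) extends Groupoid.{u} G where
  arrLE : ∀ {A B C D : G}, (A ⟶ B) → (C ⟶ D) → Prop
  arrLE_refl : ∀ {A B : G} (f : A ⟶ B), arrLE f f
  arrLE_trans : ∀ {A B C D E F : G} {f : A ⟶ B} {g : C ⟶ D} {h : E ⟶ F},
    arrLE f g → arrLE g h → arrLE f h
  arrLE_antisymm : ∀ {A B C D : G} {f : A ⟶ B} {g : C ⟶ D}, arrLE f g → arrLE g f →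
    (⟨A, B, f⟩ : Σ X Y : G, X ⟶ Y) = ⟨C, D, g⟩
  arrLE_inv : ∀ {A B C D : G} {f : A ⟶ B} {g : C ⟶ D}, arrLE f g →
    arrLE (Groupoid.inv f) (Groupoid.inv g)
  arrLE_comp : ∀ {A B C A' B' C' : G} {f : A ⟶ B} {g : B ⟶ C} {f' : A' ⟶ B'} {g' : B' ⟶ C'},
    arrLE f f' → arrLE g g' → arrLE (f ≫ g) (f' ≫ g')
  existsUnique_restrict : ∀ {A B A' : G} (f : A ⟶ B), arrLE (𝟙 A') (𝟙 A) →
    ∃! p : (Σ B' : G, A' ⟶ B'), arrLE p.2 f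

namespace OrderedGroupoid

/-- The order on objects. -/
def ObjLE {G : Type u} [OrderedGroupoid G] (A B : G) : Prop := arrLE (𝟙 A) (𝟙 B)

variable {G : Type u} [OrderedGroupoid G]

theorem ObjLE.refl (A : G) : ObjLE A A := arrLE_refl _

theorem ObjLE.trans {A B C : G} (h : ObjLE A B) (k : ObjLE B C) : ObjLE A C := arrLE_trans h k

theorem ObjLE.antisymm {A B : G} (h : ObjLE A B) (k : ObjLE B A) : A = B :=
  congrArg Sigma.fst (arrLE_antisymm h k)

theorem ObjLE.of_eq {A B : G} (h : A = B) : ObjLE A B := h ▸ ObjLE.refl A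

theorem objLE_src {A B C D : G} {f : A ⟶ B} {g : C ⟶ D} (h : arrLE f g) : ObjLE A C := by
  have := arrLE_comp h (arrLE_inv h)
  simpa [ObjLE] using this

theorem objLE_tgt {A B C D : G} {f : A ⟶ B} {g : C ⟶ D} (h : arrLE f g) : ObjLE B D := by
  have := arrLE_comp (arrLE_inv h) h
  simpa [ObjLE] using this

/-- The restriction `f|_{A'}` of `f : A ⟶ B` to an object `A' ≤ A`, together with its target. -/
noncomputable def res {A B A' : G} (f : A ⟶ B) (h : ObjLE A' A) : Σ B' : G, A' ⟶ B' :=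
  (existsUnique_restrict f h).choose

theorem res_le {A B A' : G} (f : A ⟶ B) (h : ObjLE A' A) : arrLE (res f h).2 f :=
  (existsUnique_restrict f h).choose_spec.1

theorem eq_of_le {A B A' B' B'' : G} {f : A ⟶ B} {g : A' ⟶ B'} {g' : A' ⟶ B''}
    (hg : arrLE g f) (hg' : arrLE g' f) : (⟨B', g⟩ : Σ X : G, A' ⟶ X) = ⟨B'', g'⟩ :=
  (existsUnique_restrict f (objLE_src hg)).unique hg hg'

theorem eq_res {A B A' B' : G} {f : A ⟶ B} {g : A' ⟶ B'} (h : ObjLE A' A) (hg : arrLE g f) :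
    (⟨B', g⟩ : Σ X : G, A' ⟶ X) = res f h :=
  eq_of_le hg (res_le f h)

theorem arrLE_of_star_eq {A B B' C D : G} {g : A ⟶ B} {g' : A ⟶ B'} {f : C ⟶ D}
    (e : (⟨B, g⟩ : Σ X : G, A ⟶ X) = ⟨B', g'⟩) (h : arrLE g f) : arrLE g' f := by
  cases e; exact h

theorem comp_star_eq {A B D D' : G} {h : A ⟶ B} {g : B ⟶ D} {g' : B ⟶ D'}
    (e : (⟨D, g⟩ : Σ X : G, B ⟶ X) = ⟨D', g'⟩) :
    (⟨D, h ≫ g⟩ : Σ X : G, A ⟶ X) = ⟨D', h ≫ g'⟩ := by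
  cases e; rfl

end OrderedGroupoid

open OrderedGroupoid

/-! ### The left-cancellative category of an ordered groupoid -/

/-- The objects of the category `L(G)`: those of `G`. -/
def LObj (G : Type u) : Type u := G

/-- An arrow `A ⟶ B` of `L(G)`: a formal composite of a horizontal arrow `A ⟶ B'` of `G` with a
vertical arrow `B' ≤ B`. -/
structure LHom {G : Type u} [OrderedGroupoid G] (A B : G) : Type u where
  tgt : G
  arr : A ⟶ tgt
  le : ObjLE tgt B

namespace LHom

variable {G : Type u} [OrderedGroupoid G]

/-- The horizontal part of an arrow of `L(G)`. -/
def star {A B : G} (f : LHom A B) : Σ X : G, A ⟶ X := ⟨f.tgt, f.arr⟩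

theorem ext_star {A B : G} {f g : LHom A B} (h : f.star = g.star) : f = g := by
  obtain ⟨t, a, l⟩ := f
  obtain ⟨t', a', l'⟩ := g
  cases h
  rfl

/-- The identity of `A` in `L(G)`. -/
def id (A : G) : LHom A A := ⟨A, 𝟙 A, ObjLE.refl A⟩

/-- The composite of `A ⟶ B' ≤ B` and `k : B ⟶ C' ≤ C`, which is `A ⟶ B' ⟶ C'' ≤ C` with
`k|_{B'} : B' ⟶ C''`. -/
noncomputable def comp {A B C : G} (f : LHom A B) (g : LHom B C) : LHom A C where
  tgt := (res g.arr f.le).1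
  arr := f.arr ≫ (res g.arr f.le).2
  le := (objLE_tgt (res_le g.arr f.le)).trans g.le

theorem comp_star {A B C : G} (f : LHom A B) (g : LHom B C) {D : G} (k : f.tgt ⟶ D)
    (hk : arrLE k g.arr) : (comp f g).star = ⟨D, f.arr ≫ k⟩ :=
  comp_star_eq (eq_of_le (res_le g.arr f.le) hk)

theorem id_comp {A B : G} (f : LHom A B) : comp (id A) f = f := by
  apply ext_star
  rw [comp_star (id A) f f.arr (arrLE_refl _)]
  simp [id, star]

theorem comp_id {A B : G} (f : LHom A B) : comp f (id B) = f := by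
  apply ext_star
  rw [comp_star f (id B) (𝟙 _) f.le]
  simp [star]

theorem assoc {A B C D : G} (f : LHom A B) (g : LHom B C) (h : LHom C D) :
    comp (comp f g) h = comp f (comp g h) := by
  apply ext_star
  have e := res_le g.arr f.le
  have e2 : arrLE (res h.arr (comp f g).le).2 (res h.arr g.le).2 := by
    have h3 : ObjLE (comp f g).tgt g.tgt := objLE_tgt e
    have := eq_of_le (arrLE_trans (res_le (res h.arr g.le).2 h3) (res_le h.arr g.le))
      (res_le h.arr (comp f g).le)
    exact arrLE_of_star_eq this (res_le _ _)
  rw [comp_star f (comp g h) _ (arrLE_comp e e2)]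
  simp [comp, star]

end LHom

noncomputable instance LObj.category (G : Type u) [OrderedGroupoid G] :
    Category.{u} (LObj G) where
  Hom A B := LHom (G := G) A B
  id A := LHom.id (G := G) A
  comp f g := LHom.comp f g
  id_comp f := LHom.id_comp f
  comp_id f := LHom.comp_id f
  assoc f g h := LHom.assoc f g h

theorem LHom.cancel {G : Type u} [OrderedGroupoid G] {Z A B : G} {g h : LHom Z A} {f : LHom A B}
    (e : LHom.comp g f = LHom.comp h f) : g = h := by
  have e' : (LHom.comp g f).star = (LHom.comp h f).star := congrArg LHom.star e
  apply LHom.ext_star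
  have h1 := res_le f.arr g.le
  have h2 := res_le f.arr h.le
  simp only [LHom.comp, LHom.star] at e'
  revert e' h1 h2
  generalize res f.arr g.le = r
  generalize res f.arr h.le = s
  obtain ⟨r, a⟩ := r
  obtain ⟨s, b⟩ := s
  intro e' h1 h2
  obtain rfl : r = s := congrArg Sigma.fst e'
  have e3 : g.arr ≫ a = h.arr ≫ b := by simpa using e'
  have e4 := eq_of_le (arrLE_inv h1) (arrLE_inv h2)
  have : (⟨_, (g.arr ≫ a) ≫ Groupoid.inv a⟩ : Σ X : G, _ ⟶ X) =
      ⟨_, (h.arr ≫ b) ≫ Groupoid.inv b⟩ := by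
    rw [e3]
    exact comp_star_eq e4
  rw [Category.assoc, Category.assoc, Groupoid.comp_inv, Groupoid.comp_inv, Category.comp_id,
    Category.comp_id] at this
  exact this

theorem LHom.mono {G : Type u} [OrderedGroupoid G] {A B : LObj G} (f : A ⟶ B) : Mono f :=
  ⟨fun _ _ e => LHom.cancel e⟩

/-! ### Ordered functors and their transformations -/

/-- A double functor between ordered groupoids, that is, a functor that preserves the order. -/
structure OrdFunctor (G H : Type u) [OrderedGroupoid G] [OrderedGroupoid H] extends G ⥤ H where
  mono : ∀ {A B C D : G} {f : A ⟶ B} {g : C ⟶ D}, arrLE f g → arrLE (map f) (map g)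

namespace OrdFunctor

variable {G H K : Type u} [OrderedGroupoid G] [OrderedGroupoid H] [OrderedGroupoid K]

theorem objLE (F : OrdFunctor G H) {A B : G} (h : ObjLE A B) : ObjLE (F.obj A) (F.obj B) := by
  have := F.mono h
  simpa [ObjLE] using this

/-- The identity ordered functor. -/
def id (G : Type u) [OrderedGroupoid G] : OrdFunctor G G := ⟨𝟭 G, fun h => h⟩

/-- Composition of ordered functors, in diagrammatic order. -/
def comp (F : OrdFunctor G H) (F' : OrdFunctor H K) : OrdFunctor G K :=
  ⟨F.toFunctor ⋙ F'.toFunctor, fun h => F'.mono (F.mono h)⟩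

/-- There is a (unique) vertical transformation from `F` to `F'`. -/
def VLE (F F' : OrdFunctor G H) : Prop :=
  ∀ {X Y : G} (h : X ⟶ Y), arrLE (F.map h) (F'.map h)

theorem VLE.obj {F F' : OrdFunctor G H} (h : VLE F F') (X : G) : ObjLE (F.obj X) (F'.obj X) := by
  have := h (𝟙 X)
  simpa [ObjLE] using this

theorem VLE.antisymm {F F' : OrdFunctor G H} (h : VLE F F') (k : VLE F' F) : F = F' := by
  have ho := fun X => (h.obj X).antisymm (k.obj X)
  have hm := fun {X Y : G} (f : X ⟶ Y) => arrLE_antisymm (h f) (k f)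
  obtain ⟨⟨o₁, m₁, i₁, c₁⟩, mono₁⟩ := F
  obtain ⟨⟨o₂, m₂, i₂, c₂⟩, mono₂⟩ := F'
  dsimp at *
  obtain rfl : o₁ = o₂ := funext ho
  obtain rfl : @m₁ = @m₂ := by
    funext X Y f
    simpa using hm f
  rfl

/-- A horizontal transformation: components `F X ⟶ F' X`, natural with respect to the horizontal
arrows and functorial with respect to the vertical ones. -/
@[ext]
structure HTrans (F F' : OrdFunctor G H) : Type u where
  app : ∀ X : G, F.obj X ⟶ F'.obj X
  naturality : ∀ {X Y : G} (h : X ⟶ Y), F.map h ≫ app Y = app X ≫ F'.map h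
  mono : ∀ {X Y : G}, ObjLE X Y → arrLE (app X) (app Y)

theorem HTrans.map_eq {F F' : OrdFunctor G H} (α : HTrans F F') {X Y : G} (h : X ⟶ Y) :
    F'.map h = Groupoid.inv (α.app X) ≫ F.map h ≫ α.app Y := by
  simp [α.naturality]

/-- Horizontal transformations out of `F` are determined by their components. -/
theorem hTrans_star_ext {F F₁ F₂ : OrdFunctor G H} (α : HTrans F F₁) (β : HTrans F F₂)
    (h : ∀ X, (⟨F₁.obj X, α.app X⟩ : Σ Z : H, F.obj X ⟶ Z) = ⟨F₂.obj X, β.app X⟩) :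
    (⟨F₁, α⟩ : Σ F' : OrdFunctor G H, HTrans F F') = ⟨F₂, β⟩ := by
  have hα := fun {X Y : G} (f : X ⟶ Y) => α.map_eq f
  have hβ := fun {X Y : G} (f : X ⟶ Y) => β.map_eq f
  obtain ⟨⟨o₁, m₁, i₁, c₁⟩, mono₁⟩ := F₁
  obtain ⟨⟨o₂, m₂, i₂, c₂⟩, mono₂⟩ := F₂
  obtain ⟨a, na, ma⟩ := α
  obtain ⟨b, nb, mb⟩ := β
  dsimp at *
  obtain rfl : o₁ = o₂ := funext fun X => congrArg Sigma.fst (h X)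
  obtain rfl : a = b := funext fun X => by simpa using h X
  obtain rfl : @m₁ = @m₂ := by
    funext X Y f
    rw [hα f, hβ f]
  rfl

instance groupoid : Groupoid.{u} (OrdFunctor G H) where
  Hom F F' := HTrans F F'
  id F := ⟨fun X => 𝟙 _, by simp, fun h => F.objLE h⟩
  comp α β := ⟨fun X => α.app X ≫ β.app X,
    fun h => by rw [← Category.assoc, α.naturality, Category.assoc, β.naturality, Category.assoc],
    fun h => arrLE_comp (α.mono h) (β.mono h)⟩
  id_comp α := by apply HTrans.ext; simp
  comp_id α := by apply HTrans.ext; simp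
  assoc α β γ := by apply HTrans.ext; simp
  inv α := ⟨fun X => Groupoid.inv (α.app X),
    fun h => by simp [α.map_eq h],
    fun h => arrLE_inv (α.mono h)⟩
  inv_comp α := by apply HTrans.ext; simp
  comp_inv α := by apply HTrans.ext; simp

theorem id_app (F : OrdFunctor G H) (X : G) : HTrans.app (𝟙 F) X = 𝟙 (F.obj X) := rfl

theorem comp_app {F F' F'' : OrdFunctor G H} (α : F ⟶ F') (β : F' ⟶ F'') (X : G) :
    HTrans.app (α ≫ β) X = HTrans.app α X ≫ HTrans.app β X := rfl

/-- There is a (unique) modification from `α` to `β`, with vertical sides `F₁ ≤ F₂` and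
`F₁' ≤ F₂'`. -/
def ModLE {F₁ F₁' F₂ F₂' : OrdFunctor G H} (α : HTrans F₁ F₁') (β : HTrans F₂ F₂') : Prop :=
  VLE F₁ F₂ ∧ VLE F₁' F₂' ∧ ∀ X, arrLE (α.app X) (β.app X)

theorem exists_restrict {F F₁ F₁' : OrdFunctor G H} (β : HTrans F₁ F₁') (h : VLE F F₁) :
    ∃ p : (Σ F' : OrdFunctor G H, HTrans F F'), ModLE p.2 β := by
  let r := fun X : G => res (β.app X) (h.obj X)
  have hr : ∀ X, arrLE (r X).2 (β.app X) := fun X => res_le _ _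
  have hm : ∀ {X Y : G}, ObjLE X Y → arrLE (r X).2 (r Y).2 := by
    intro X Y hXY
    have h1 : ObjLE (F.obj X) (F.obj Y) := F.objLE hXY
    exact arrLE_of_star_eq (eq_of_le (arrLE_trans (res_le (r Y).2 h1) (hr Y))
      (arrLE_trans (hr X) (β.mono hXY))) (res_le _ _)
  let F' : OrdFunctor G H :=
    { obj := fun X => (r X).1
      map := fun {X Y} f => Groupoid.inv (r X).2 ≫ F.map f ≫ (r Y).2
      map_id := by simp
      map_comp := by simp
      mono := fun {A B C D f g} hfg => arrLE_comp (arrLE_inv (hm (objLE_src hfg)))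
        (arrLE_comp (F.mono hfg) (hm (objLE_tgt hfg))) }
  refine ⟨⟨F', ⟨fun X => (r X).2, fun f => by simp [F'], hm⟩⟩, h, ?_, hr⟩
  intro X Y f
  rw [β.map_eq f]
  exact arrLE_comp (arrLE_inv (hr X)) (arrLE_comp (h f) (hr Y))

/-- The double category of ordered functors, horizontal and vertical transformations and
modifications is again an ordered groupoid. -/
instance orderedGroupoid : OrderedGroupoid (OrdFunctor G H) where
  arrLE α β := ModLE α β
  arrLE_refl α := ⟨fun _ => arrLE_refl _, fun _ => arrLE_refl _, fun _ => arrLE_refl _⟩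
  arrLE_trans h k := ⟨fun f => arrLE_trans (h.1 f) (k.1 f),
    fun f => arrLE_trans (h.2.1 f) (k.2.1 f), fun X => arrLE_trans (h.2.2 X) (k.2.2 X)⟩
  arrLE_antisymm := by
    intro F₁ F₁' F₂ F₂' α β h k
    obtain rfl : F₁ = F₂ := VLE.antisymm h.1 k.1
    obtain rfl : F₁' = F₂' := VLE.antisymm h.2.1 k.2.1
    obtain rfl : α = β := HTrans.ext (funext fun X => by
      simpa using arrLE_antisymm (h.2.2 X) (k.2.2 X))
    rfl
  arrLE_inv h := ⟨h.2.1, h.1, fun X => arrLE_inv (h.2.2 X)⟩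
  arrLE_comp h k := ⟨h.1, k.2.1, fun X => arrLE_comp (h.2.2 X) (k.2.2 X)⟩
  existsUnique_restrict := by
    intro F₁ F₁' F β h
    obtain ⟨p, hp⟩ := exists_restrict β h.1
    refine ⟨p, hp, ?_⟩
    rintro ⟨F', γ⟩ hγ
    exact hTrans_star_ext _ _ fun X => eq_of_le (hγ.2.2 X) (hp.2.2 X)

end OrdFunctor

/-! ### The functor `L` on ordered functors -/

section LMap

variable {G H K : Type u} [OrderedGroupoid G] [OrderedGroupoid H] [OrderedGroupoid K]

/-- The action of an ordered functor on arrows of `L(G)`. -/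
def LHom.map (F : OrdFunctor G H) {A B : G} (f : LHom A B) : LHom (F.obj A) (F.obj B) :=
  ⟨F.obj f.tgt, F.map f.arr, F.objLE f.le⟩

theorem LHom.map_id (F : OrdFunctor G H) (A : G) : (LHom.id A).map F = LHom.id (F.obj A) :=
  LHom.ext_star (by simp [LHom.star, LHom.map, LHom.id])

theorem LHom.map_comp (F : OrdFunctor G H) {A B C : G} (f : LHom A B) (g : LHom B C) :
    (LHom.comp f g).map F = LHom.comp (f.map F) (g.map F) := by
  apply LHom.ext_star
  rw [LHom.comp_star (f.map F) (g.map F) _ (F.mono (res_le g.arr f.le))]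
  simp [LHom.star, LHom.map, LHom.comp]

/-- The functor `L(F) : L(G) ⥤ L(H)`. -/
def LFunctor (F : OrdFunctor G H) : LObj G ⥤ LObj H where
  obj A := F.obj A
  map f := LHom.map F f
  map_id A := LHom.map_id F A
  map_comp f g := LHom.map_comp F f g

end LMap

/-! ### The 2-category of ordered groupoids -/

/-- A `Λ`-transformation `F ⇒ F'`: an arrow of `L` of the ordered groupoid of ordered functors,
that is, a horizontal transformation `F ⟶ F''` followed by a vertical one `F'' ≤ F'`. -/
abbrev LambdaTrans {G H : Type u} [OrderedGroupoid G] [OrderedGroupoid H]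
    (F F' : OrdFunctor G H) : Type u := LHom F F'

namespace OrdFunctor

variable {G H K : Type u} [OrderedGroupoid G] [OrderedGroupoid H] [OrderedGroupoid K]

theorem vle_of_objLE {F F' : OrdFunctor G H} (h : ObjLE F F') : VLE F F' := h.1

theorem objLE_of_vle {F F' : OrdFunctor G H} (h : VLE F F') : ObjLE F F' := ⟨h, h, h.obj⟩

/-- Left whiskering of transformations and modifications with a fixed `F`, as an ordered
functor. -/
def precomp (F : OrdFunctor G H) : OrdFunctor (OrdFunctor H K) (OrdFunctor G K) where
  obj P := F.comp P
  map α := ⟨fun X => HTrans.app α (F.obj X), fun h => HTrans.naturality α (F.map h),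
    fun h => HTrans.mono α (F.objLE h)⟩
  map_id _ := rfl
  map_comp _ _ := rfl
  mono h := ⟨fun f => h.1 (F.map f), fun f => h.2.1 (F.map f), fun X => h.2.2 (F.obj X)⟩

/-- Right whiskering of transformations and modifications with a fixed `P`, as an ordered
functor. -/
def postcomp (P : OrdFunctor H K) : OrdFunctor (OrdFunctor G H) (OrdFunctor G K) where
  obj F := F.comp P
  map α := ⟨fun X => P.map (HTrans.app α X),
    fun h => by
      change P.map _ ≫ P.map _ = P.map _ ≫ P.map _
      rw [← P.map_comp, HTrans.naturality, P.map_comp],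
    fun h => P.mono (HTrans.mono α h)⟩
  map_id F := HTrans.ext (funext fun X => P.map_id _)
  map_comp α β := HTrans.ext (funext fun X => P.map_comp _ _)
  mono h := ⟨fun f => P.mono (h.1 f), fun f => P.mono (h.2.1 f), fun X => P.mono (h.2.2 X)⟩

end OrdFunctor

namespace LambdaTrans

open OrdFunctor

variable {G H K : Type u} [OrderedGroupoid G] [OrderedGroupoid H] [OrderedGroupoid K]

/-- The component of a `Λ`-transformation at an object, an arrow of `L(H)`. -/
def app {F F' : OrdFunctor G H} (α : LambdaTrans F F') (X : G) : LHom (F.obj X) (F'.obj X) :=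
  ⟨α.tgt.obj X, HTrans.app α.arr X, VLE.obj (vle_of_objLE α.le) X⟩

theorem ext_app {F F' : OrdFunctor G H} {α β : LambdaTrans F F'}
    (h : ∀ X, α.app X = β.app X) : α = β :=
  LHom.ext_star (hTrans_star_ext _ _ fun X => congrArg LHom.star (h X))

theorem id_app (F : OrdFunctor G H) (X : G) : app (LHom.id F) X = LHom.id (F.obj X) := rfl

theorem comp_app {F F' F'' : OrdFunctor G H} (α : LambdaTrans F F') (β : LambdaTrans F' F'')
    (X : G) : app (LHom.comp α β) X = LHom.comp (app α X) (app β X) := by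
  apply LHom.ext_star
  exact (LHom.comp_star (app α X) (app β X) _ ((res_le β.arr α.le).2.2 X)).symm

/-- Left whiskering. -/
def whiskerLeft (F : OrdFunctor G H) {P P' : OrdFunctor H K} (α : LambdaTrans P P') :
    LambdaTrans (F.comp P) (F.comp P') := α.map F.precomp

/-- Right whiskering. -/
def whiskerRight {F F' : OrdFunctor G H} (α : LambdaTrans F F') (P : OrdFunctor H K) :
    LambdaTrans (F.comp P) (F'.comp P) := α.map P.postcomp

theorem whiskerLeft_app (F : OrdFunctor G H) {P P' : OrdFunctor H K} (α : LambdaTrans P P')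
    (X : G) : (whiskerLeft F α).app X = α.app (F.obj X) := rfl

theorem whiskerRight_app {F F' : OrdFunctor G H} (α : LambdaTrans F F') (P : OrdFunctor H K)
    (X : G) : (whiskerRight α P).app X = (α.app X).map P := rfl

/-- A `Λ`-transformation is natural with respect to the arrows of `L(G)`. -/
theorem naturality {F F' : OrdFunctor G H} (α : LambdaTrans F F') {A B : G} (f : LHom A B) :
    LHom.comp (f.map F) (α.app B) = LHom.comp (α.app A) (f.map F') := by
  apply LHom.ext_star
  rw [LHom.comp_star (f.map F) (α.app B) _ (HTrans.mono α.arr f.le),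
    LHom.comp_star (α.app A) (f.map F') _ (vle_of_objLE α.le f.arr)]
  exact congrArg (fun k => (⟨α.tgt.obj f.tgt, k⟩ : Σ Z : H, F.obj A ⟶ Z))
    (HTrans.naturality α.arr f.arr)

theorem exchange {F F' : OrdFunctor G H} {P P' : OrdFunctor H K} (α : LambdaTrans F F')
    (β : LambdaTrans P P') :
    LHom.comp (whiskerLeft F β) (whiskerRight α P') =
      LHom.comp (whiskerRight α P) (whiskerLeft F' β) := by
  apply ext_app
  intro X
  rw [comp_app, comp_app]
  exact (naturality β (α.app X)).symm

theorem whiskerLeft_id (F : OrdFunctor G H) (P : OrdFunctor H K) :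
    whiskerLeft F (LHom.id P) = LHom.id (F.comp P) := LHom.map_id _ _

theorem whiskerRight_id (F : OrdFunctor G H) (P : OrdFunctor H K) :
    whiskerRight (LHom.id F) P = LHom.id (F.comp P) := LHom.map_id _ _

theorem comp_ids {F : OrdFunctor G H} {α β : LambdaTrans F F} (hα : α = LHom.id F)
    (hβ : β = LHom.id F) :
    LHom.comp α (LHom.comp (LHom.id F) β) = LHom.comp (LHom.id F) (LHom.id F) := by
  subst hα hβ
  rw [LHom.id_comp]

end LambdaTrans

/-- Bundled ordered groupoids. -/
structure OGpd : Type (u + 1) where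
  carrier : Type u
  [str : OrderedGroupoid carrier]

namespace OGpd

instance (𝒢 : OGpd.{u}) : OrderedGroupoid 𝒢.carrier := 𝒢.str

noncomputable instance categoryStruct : CategoryStruct.{u} OGpd.{u} where
  Hom 𝒢 ℋ := LObj (OrdFunctor 𝒢.carrier ℋ.carrier)
  id 𝒢 := OrdFunctor.id 𝒢.carrier
  comp F P := OrdFunctor.comp F P

noncomputable instance homCategory (𝒢 ℋ : OGpd.{u}) : Category.{u} (𝒢 ⟶ ℋ) :=
  LObj.category (OrdFunctor 𝒢.carrier ℋ.carrier)

theorem sandwich {𝒢 ℋ : OGpd.{u}} {F F' : 𝒢 ⟶ ℋ} (α : F ⟶ F') :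
    α = (Iso.refl F).hom ≫ α ≫ (Iso.refl F').inv := by simp

/-- The 2-category of ordered groupoids, ordered functors and `Λ`-transformations; its
hom-categories are `L` of the ordered groupoids of ordered functors. -/
noncomputable instance bicategory : Bicategory.{u, u} OGpd.{u} where
  homCategory 𝒢 ℋ := OGpd.homCategory 𝒢 ℋ
  whiskerLeft F _ _ α := LambdaTrans.whiskerLeft F α
  whiskerRight α P := LambdaTrans.whiskerRight α P
  associator _ _ _ := Iso.refl _
  leftUnitor _ := Iso.refl _
  rightUnitor _ := Iso.refl _
  whiskerLeft_id _ _ := LHom.map_id _ _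
  whiskerLeft_comp _ _ _ _ α β := LHom.map_comp _ α β
  id_whiskerLeft α := sandwich α
  comp_whiskerLeft F F' _ _ α := sandwich (LambdaTrans.whiskerLeft F (LambdaTrans.whiskerLeft F' α))
  id_whiskerRight _ _ := LHom.map_id _ _
  comp_whiskerRight α β _ := LHom.map_comp _ α β
  whiskerRight_id α := sandwich α
  whiskerRight_comp α P Q := sandwich (LambdaTrans.whiskerRight (LambdaTrans.whiskerRight α P) Q)
  whisker_assoc F _ _ α P := sandwich (LambdaTrans.whiskerLeft F (LambdaTrans.whiskerRight α P))
  whisker_exchange α β := LambdaTrans.exchange α β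
  pentagon F P Q R := LambdaTrans.comp_ids
    (LambdaTrans.whiskerRight_id (OrdFunctor.comp (OrdFunctor.comp F P) Q) R)
    (LambdaTrans.whiskerLeft_id F (OrdFunctor.comp (OrdFunctor.comp P Q) R))
  triangle F P := (LHom.id_comp _).trans
    ((LambdaTrans.whiskerLeft_id F P).trans (LambdaTrans.whiskerRight_id F P).symm)

instance : Bicategory.Strict OGpd.{u} where
  id_comp _ := rfl
  comp_id _ := rfl
  assoc _ _ _ := rfl
  leftUnitor_eqToIso _ := rfl
  rightUnitor_eqToIso _ := rfl
  associator_eqToIso _ _ _ := rfl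

end OGpd

/-! ### The 2-category of left-cancellative categories and the 2-functor `L` -/

/-- A category is left-cancellative if all its arrows are monomorphisms. -/
class LeftCancellative (C : Type u) [Category.{u} C] : Prop where
  mono : ∀ {X Y : C} (f : X ⟶ Y), Mono f

instance LObj.leftCancellative (G : Type u) [OrderedGroupoid G] : LeftCancellative (LObj G) :=
  ⟨LHom.mono⟩

/-- The 2-category of (small) left-cancellative categories, functors and natural
transformations, as a full sub-2-category of `Cat`. -/
abbrev LCCat : Type (u + 1) :=
  Bicategory.InducedBicategory Cat.{u, u}
    (fun C : {C : Cat.{u, u} // LeftCancellative C} => C.1)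

namespace LCCat

/-- The left-cancellative category given by a type with a category structure. -/
def of (C : Type u) [Category.{u} C] [h : LeftCancellative C] : LCCat.{u} := ⟨Cat.of C, h⟩

/-- The type of objects. -/
abbrev carrier (C : LCCat.{u}) : Type u := C.1

instance (C : LCCat.{u}) : LeftCancellative C.carrier := C.2

/-- A functor as a 1-cell. -/
abbrev ofFunctor {C D : LCCat.{u}} (F : C.carrier ⥤ D.carrier) : C ⟶ D :=
  Bicategory.InducedBicategory.mkHom (Functor.toCatHom F)

/-- The functor underlying a 1-cell. -/
abbrev functor {C D : LCCat.{u}} (F : C ⟶ D) : C.carrier ⥤ D.carrier := F.hom.toFunctor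

/-- The natural transformation underlying a 2-cell. -/
abbrev natTrans {C D : LCCat.{u}} {F F' : C ⟶ D} (α : F ⟶ F') : functor F ⟶ functor F' :=
  α.hom.toNatTrans

/-- A natural transformation as a 2-cell. -/
abbrev ofNatTrans {C D : LCCat.{u}} {F F' : C ⟶ D} (α : functor F ⟶ functor F') : F ⟶ F' :=
  ⟨⟨α⟩⟩

theorem hom₂_ext {C D : LCCat.{u}} {F F' : C ⟶ D} {α β : F ⟶ F'}
    (h : ∀ X, (natTrans α).app X = (natTrans β).app X) : α = β :=
  Bicategory.InducedBicategory.hom₂_ext (Cat.Hom₂.ext (NatTrans.ext (funext h)))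

end LCCat

/-- The natural transformation `L(α) : L(F) ⟶ L(F')`, with the components of `α`. -/
def LNatTrans {G H : Type u} [OrderedGroupoid G] [OrderedGroupoid H] {F F' : OrdFunctor G H}
    (α : LambdaTrans F F') : LFunctor F ⟶ LFunctor F' where
  app X := α.app X
  naturality _ _ f := α.naturality f

theorem eq_eqToHom_comp {C : Type*} [Category C] {X Y : C} (h : X = X) (h' : Y = Y) (f : X ⟶ Y) :
    f = eqToHom h ≫ f ≫ eqToHom h' := by simp

open Bicategory in
/-- The 2-functor `L` from ordered groupoids to left-cancellative categories. -/
noncomputable def lawsonL : StrictPseudofunctor OGpd.{u} LCCat.{u} :=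
  StrictPseudofunctor.mk''
    { obj := fun 𝒢 => LCCat.of (LObj 𝒢.carrier)
      map := fun {𝒢 ℋ} F => LCCat.ofFunctor
        (LFunctor (G := 𝒢.carrier) (H := ℋ.carrier) F)
      map₂ := fun {𝒢 ℋ _ _} α => LCCat.ofNatTrans
        (LNatTrans (G := 𝒢.carrier) (H := ℋ.carrier) α)
      map₂_id := fun _ => rfl
      map₂_comp := fun {_ _ _ _ _} α β => LCCat.hom₂_ext (by
        intro X
        exact LambdaTrans.comp_app α β X)
      map_id := fun _ => rfl
      map_comp := fun _ _ => rfl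
      map₂_whisker_left := fun _ _ _ _ => eq_eqToHom_comp rfl rfl _
      map₂_whisker_right := fun _ _ => eq_eqToHom_comp rfl rfl _ }

/-! ### The ordered groupoid of a left-cancellative category -/

/-- A representative `arr : dom ⟶ cod` of a subobject. -/
structure SubRep (C : Type u) [Category.{u} C] : Type u where
  {dom : C}
  {cod : C}
  arr : dom ⟶ cod

/-- A span `left ⟵ apex ⟶ right`. -/
structure SpanRep (C : Type u) [Category.{u} C] : Type u where
  {apex : C}
  {left : C}
  {right : C}
  l : apex ⟶ left
  r : apex ⟶ right

/-- `m ~ m'` if they have the same codomain and `m = m' k` for some isomorphism `k`. -/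
inductive SubRep.Rel {C : Type u} [Category.{u} C] : SubRep C → SubRep C → Prop
  | mk {A A' B : C} (k : A ≅ A') (m' : A' ⟶ B) : Rel ⟨k.hom ≫ m'⟩ ⟨m'⟩

/-- `(l, r) ~ (l', r')` if they have the same feet and `l = l' k`, `r = r' k` for some
isomorphism `k`. -/
inductive SpanRep.Rel {C : Type u} [Category.{u} C] : SpanRep C → SpanRep C → Prop
  | mk {A A' B B' : C} (k : A ≅ A') (l' : A' ⟶ B) (r' : A' ⟶ B') :
      Rel ⟨k.hom ≫ l', k.hom ≫ r'⟩ ⟨l', r'⟩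

section GObj

variable {C : Type u} [Category.{u} C]

theorem SubRep.Rel.of_eq {A A' B : C} {m : A ⟶ B} {m' : A' ⟶ B} (k : A ≅ A')
    (h : k.hom ≫ m' = m) : SubRep.Rel ⟨m⟩ ⟨m'⟩ := h ▸ .mk k m'

theorem SubRep.Rel.exists_iso {s : SubRep C} {A' B : C} {m' : A' ⟶ B}
    (h : SubRep.Rel s ⟨m'⟩) : ∃ (A : C) (k : A ≅ A'), s = ⟨k.hom ≫ m'⟩ := by
  cases h with
  | mk k => exact ⟨_, k, rfl⟩

theorem SpanRep.Rel.of_eq {A A' B B' : C} {l : A ⟶ B} {r : A ⟶ B'} {l' : A' ⟶ B} {r' : A' ⟶ B'}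
    (k : A ≅ A') (h : k.hom ≫ l' = l) (h' : k.hom ≫ r' = r) : SpanRep.Rel ⟨l, r⟩ ⟨l', r'⟩ :=
  h ▸ h' ▸ .mk k l' r'

theorem SpanRep.Rel.exists_iso {s : SpanRep C} {A' D D' : C} {l' : A' ⟶ D} {r' : A' ⟶ D'}
    (h : SpanRep.Rel s ⟨l', r'⟩) : ∃ (A : C) (k : A ≅ A'), s = ⟨k.hom ≫ l', k.hom ≫ r'⟩ := by
  cases h with
  | mk k => exact ⟨_, k, rfl⟩

variable (C)

instance SubRep.setoid : Setoid (SubRep C) where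
  r := SubRep.Rel
  iseqv :=
    { refl := fun _ => .of_eq (Iso.refl _) (by simp)
      symm := fun h => by
        obtain ⟨k, m⟩ := h
        exact .of_eq k.symm (by simp)
      trans := fun h h' => by
        obtain ⟨k', m'⟩ := h'
        obtain ⟨_, k, rfl⟩ := h.exists_iso
        exact .of_eq (k ≪≫ k') (by simp) }

instance SpanRep.setoid : Setoid (SpanRep C) where
  r := SpanRep.Rel
  iseqv :=
    { refl := fun _ => .of_eq (Iso.refl _) (by simp) (by simp)
      symm := fun h => by
        obtain ⟨k, l, r⟩ := h
        exact .of_eq k.symm (by simp) (by simp)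
      trans := fun h h' => by
        obtain ⟨k', l, r⟩ := h'
        obtain ⟨_, k, rfl⟩ := h.exists_iso
        exact .of_eq (k ≪≫ k') (by simp) (by simp) }

/-- The objects of `G(C)`: subobjects in `C`. -/
def GObj : Type u := Quotient (SubRep.setoid C)

/-- The horizontal arrows of `G(C)`: equivalence classes of spans in `C`. -/
def GArr : Type u := Quotient (SpanRep.setoid C)

variable {C}

/-- The subobject `[m]`. -/
def GObj.mk {A B : C} (m : A ⟶ B) : GObj C := Quotient.mk (SubRep.setoid C) ⟨m⟩

theorem GObj.exists_rep (P : GObj C) : ∃ (A B : C) (m : A ⟶ B), P = GObj.mk m := by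
  induction P using Quotient.inductionOn with
  | h m => exact ⟨_, _, m.arr, rfl⟩

theorem GObj.sound {A A' B : C} {m : A ⟶ B} {m' : A' ⟶ B} (k : A ≅ A')
    (h : k.hom ≫ m' = m) : GObj.mk m = GObj.mk m' := Quotient.sound (SubRep.Rel.of_eq k h)

theorem GObj.exact {A A' B B' : C} {m : A ⟶ B} {m' : A' ⟶ B'} (h : GObj.mk m = GObj.mk m') :
    ∃ (e : B' = B) (k : A ≅ A'), k.hom ≫ m' ≫ eqToHom e = m := by
  have h' : SubRep.Rel ⟨m⟩ ⟨m'⟩ := Quotient.exact h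
  cases h' with
  | mk k => exact ⟨rfl, k, by simp⟩

namespace GArr

/-- The class `[l, r]` of a span. -/
def mk {A B B' : C} (l : A ⟶ B) (r : A ⟶ B') : GArr C := Quotient.mk (SpanRep.setoid C) ⟨l, r⟩

theorem exists_rep (s : GArr C) : ∃ (A B B' : C) (l : A ⟶ B) (r : A ⟶ B'), s = mk l r := by
  induction s using Quotient.inductionOn with
  | h s => exact ⟨_, _, _, s.l, s.r, rfl⟩

theorem sound {A A' B B' : C} {l : A ⟶ B} {r : A ⟶ B'} {l' : A' ⟶ B} {r' : A' ⟶ B'}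
    (k : A ≅ A') (h : k.hom ≫ l' = l) (h' : k.hom ≫ r' = r) : mk l r = mk l' r' :=
  Quotient.sound (SpanRep.Rel.of_eq k h h')

/-- `[l, r]` is an arrow from `[l]`. -/
def src : GArr C → GObj C :=
  Quotient.lift (fun s => GObj.mk s.l) (by
    rintro _ _ ⟨k, l, r⟩
    exact GObj.sound k rfl)

/-- `[l, r]` is an arrow to `[r]`. -/
def tgt : GArr C → GObj C :=
  Quotient.lift (fun s => GObj.mk s.r) (by
    rintro _ _ ⟨k, l, r⟩
    exact GObj.sound k rfl)

/-- The identity arrow `[m, m]` of `[m]`. -/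
def one : GObj C → GArr C :=
  Quotient.lift (fun m => mk m.arr m.arr) (by
    rintro _ _ ⟨k, m⟩
    exact sound k rfl rfl)

/-- The inverse `[r, l]` of `[l, r]`. -/
def inv : GArr C → GArr C :=
  Quotient.lift (fun s => mk s.r s.l) (by
    rintro _ _ ⟨k, l, r⟩
    exact sound k rfl rfl)

/-- `Comp s t u` says that `u` is the composite of `s` and `t`: `[k, m]` followed by `[m, n]` is
`[k, n]`. -/
inductive Comp : GArr C → GArr C → GArr C → Prop
  | mk {A B₁ B₂ B₃ : C} (k : A ⟶ B₁) (m : A ⟶ B₂) (n : A ⟶ B₃) :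
      Comp (mk k m) (mk m n) (mk k n)

/-- The order: `[l, r] ≤ [l', r']` if `l = l' k` and `r = r' k` for some arrow `k`. -/
inductive LE : GArr C → GArr C → Prop
  | mk {A A' B B' : C} (k : A ⟶ A') (l' : A' ⟶ B) (r' : A' ⟶ B') :
      LE (mk (k ≫ l') (k ≫ r')) (mk l' r')

theorem LE.of_eq {A A' B B' : C} {l : A ⟶ B} {r : A ⟶ B'} {l' : A' ⟶ B} {r' : A' ⟶ B'}
    (k : A ⟶ A') (h : k ≫ l' = l) (h' : k ≫ r' = r) : LE (GArr.mk l r) (GArr.mk l' r') :=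
  h ▸ h' ▸ .mk k l' r'

theorem exact {A A' B B' D D' : C} {l : A ⟶ B} {r : A ⟶ B'} {l' : A' ⟶ D} {r' : A' ⟶ D'}
    (h : mk l r = mk l' r') : ∃ (e : D = B) (e' : D' = B') (k : A ≅ A'),
      k.hom ≫ l' ≫ eqToHom e = l ∧ k.hom ≫ r' ≫ eqToHom e' = r := by
  have h' : SpanRep.Rel ⟨l, r⟩ ⟨l', r'⟩ := Quotient.exact h
  cases h' with
  | mk k => exact ⟨rfl, rfl, k, by simp, by simp⟩

theorem LE.exists_factor {s : GArr C} {A B B' : C} {l : A ⟶ B} {r : A ⟶ B'}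
    (h : LE s (GArr.mk l r)) : ∃ (A' : C) (k : A' ⟶ A), s = GArr.mk (k ≫ l) (k ≫ r) := by
  generalize ht : GArr.mk l r = t at h
  obtain ⟨k, l', r'⟩ := h
  obtain ⟨e, e', j, h₁, h₂⟩ := GArr.exact ht.symm
  cases e
  cases e'
  refine ⟨_, k ≫ j.hom, ?_⟩
  simp only [eqToHom_refl, Category.comp_id] at h₁ h₂
  rw [← h₁, ← h₂, Category.assoc, Category.assoc]

theorem exists_rep_of_src {s : GArr C} {A B : C} {l : A ⟶ B} (h : s.src = GObj.mk l) :
    ∃ (B' : C) (r : A ⟶ B'), s = mk l r := by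
  obtain ⟨A', B₁, B', l', r, rfl⟩ := s.exists_rep
  obtain ⟨e, k, hk⟩ := GObj.exact (show GObj.mk l' = GObj.mk l from h)
  cases e
  exact ⟨B', k.inv ≫ r, sound k (by simpa using hk) (by simp)⟩

theorem exists_rep_of_tgt {s : GArr C} {A B : C} {r : A ⟶ B} (h : s.tgt = GObj.mk r) :
    ∃ (B' : C) (l : A ⟶ B'), s = mk l r := by
  obtain ⟨A', B', B₁, l, r', rfl⟩ := s.exists_rep
  obtain ⟨e, k, hk⟩ := GObj.exact (show GObj.mk r' = GObj.mk r from h)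
  cases e
  exact ⟨B', k.inv ≫ l, sound k (by simp) (by simpa using hk)⟩

theorem exists_comp {s t : GArr C} (h : s.tgt = t.src) : ∃ u, Comp s t u := by
  obtain ⟨A, B, B', l, r, rfl⟩ := s.exists_rep
  obtain ⟨B'', n, rfl⟩ := exists_rep_of_src h.symm
  exact ⟨_, .mk l r n⟩

theorem Comp.src_eq {s t u : GArr C} (h : Comp s t u) : u.src = s.src := by
  obtain ⟨k, m, n⟩ := h; rfl

theorem Comp.tgt_eq {s t u : GArr C} (h : Comp s t u) : u.tgt = t.tgt := by
  obtain ⟨k, m, n⟩ := h; rfl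

theorem LE.src_le {s t : GArr C} (h : LE s t) : LE (one s.src) (one t.src) := by
  obtain ⟨k, l, r⟩ := h
  exact .mk k l l

theorem LE.refl (s : GArr C) : LE s s := by
  obtain ⟨A, B, B', l, r, rfl⟩ := s.exists_rep
  exact .of_eq (𝟙 _) (by simp) (by simp)

theorem LE.trans {s t u : GArr C} (h : LE s t) (h' : LE t u) : LE s u := by
  obtain ⟨k, l, r⟩ := h'
  obtain ⟨_, j, rfl⟩ := h.exists_factor
  exact .of_eq (j ≫ k) (by simp) (by simp)

theorem LE.inv {s t : GArr C} (h : LE s t) : LE s.inv t.inv := by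
  obtain ⟨k, l, r⟩ := h
  exact .mk k r l

variable [LeftCancellative C]

instance instMono {A B : C} (m : A ⟶ B) : Mono m := LeftCancellative.mono m

theorem Comp.eq_mk {u : GArr C} {A B₁ B₂ B₃ : C} {k : A ⟶ B₁} {m : A ⟶ B₂} {n : A ⟶ B₃}
    (h : Comp (GArr.mk k m) (GArr.mk m n) u) : u = GArr.mk k n := by
  generalize hs : GArr.mk k m = s at h
  generalize ht : GArr.mk m n = t at h
  obtain ⟨k', m', n'⟩ := h
  obtain ⟨e₁, e₂, i, h₁, h₂⟩ := GArr.exact hs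
  obtain ⟨e₃, e₄, j, h₃, h₄⟩ := GArr.exact ht
  cases e₁
  cases e₂
  cases e₄
  simp only [eqToHom_refl, Category.comp_id] at h₁ h₂ h₃ h₄
  have hij : i.hom = j.hom := by rw [← cancel_mono m', h₂, h₃]
  exact (sound i h₁ (hij ▸ h₄)).symm

theorem Comp.unique {s t u u' : GArr C} (h : Comp s t u) (h' : Comp s t u') : u = u' := by
  obtain ⟨k, m, n⟩ := h
  exact h'.eq_mk.symm

theorem LE.antisymm {s t : GArr C} (h : LE s t) (h' : LE t s) : s = t := by
  obtain ⟨k, l, r⟩ := h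
  generalize ht : GArr.mk l r = t at h'
  generalize hs : GArr.mk (k ≫ l) (k ≫ r) = s at h'
  obtain ⟨A₁, j, hj⟩ := (hs.symm ▸ h').exists_factor
  rw [← ht] at hj
  obtain ⟨e₁, e₂, i, h₁, h₂⟩ := GArr.exact hj
  simp only [eqToHom_refl, Category.comp_id] at h₁ h₂
  have h₃ : (i.hom ≫ j) ≫ k = 𝟙 _ := by
    rw [← cancel_mono l]
    simpa using h₁
  have h₄ : k ≫ i.hom ≫ j = 𝟙 _ := by
    rw [← cancel_mono k, Category.assoc, h₃]
    simp
  rw [← hs, ← ht]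
  exact sound ⟨k, i.hom ≫ j, h₄, h₃⟩ rfl rfl

theorem LE.comp {s t u s' t' u' : GArr C} (h : LE s s') (h' : LE t t') (hu : Comp s t u)
    (hu' : Comp s' t' u') : LE u u' := by
  obtain ⟨k, m, n⟩ := hu'
  obtain ⟨A, i, rfl⟩ := h.exists_factor
  obtain ⟨A', j, rfl⟩ := h'.exists_factor
  have e : GObj.mk (i ≫ m) = GObj.mk (j ≫ m) := by
    generalize hs : GArr.mk (i ≫ k) (i ≫ m) = s at hu
    generalize ht : GArr.mk (j ≫ m) (j ≫ n) = t at hu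
    have h₁ := congrArg tgt hs
    have h₂ := congrArg src ht
    obtain ⟨k, m', n⟩ := hu
    exact h₁.trans h₂.symm
  obtain ⟨e, a, ha⟩ := GObj.exact e
  simp only [eqToHom_refl, Category.comp_id] at ha
  have hij : a.hom ≫ j = i := by
    rw [← cancel_mono m, Category.assoc, ha]
  have : GArr.mk (j ≫ m) (j ≫ n) = GArr.mk (i ≫ m) (i ≫ n) :=
    (sound a (by rw [← hij, Category.assoc]) (by rw [← hij, Category.assoc])).symm
  rw [this] at hu
  rw [hu.eq_mk]
  exact .mk i k n

theorem existsUnique_restrict {s : GArr C} {P : GObj C} (h : LE (one P) (one s.src)) :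
    ∃! t : GArr C, t.src = P ∧ LE t s := by
  obtain ⟨A, B, B', l, r, rfl⟩ := s.exists_rep
  have h' : LE (one P) (GArr.mk l l) := h
  obtain ⟨A', k, hk⟩ := h'.exists_factor
  have hP : P = GObj.mk (k ≫ l) := by
    obtain ⟨_, _, m, rfl⟩ := P.exists_rep
    exact congrArg src hk
  subst hP
  refine ⟨GArr.mk (k ≫ l) (k ≫ r), ⟨rfl, .mk k l r⟩, ?_⟩
  rintro t ⟨ht, hts⟩
  obtain ⟨A₁, j, rfl⟩ := hts.exists_factor
  obtain ⟨e, a, ha⟩ := GObj.exact (show GObj.mk (j ≫ l) = GObj.mk (k ≫ l) from ht)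
  simp only [eqToHom_refl, Category.comp_id] at ha
  have hij : a.hom ≫ k = j := by
    rw [← cancel_mono l, Category.assoc, ha]
  exact sound a (by rw [← hij, Category.assoc]) (by rw [← hij, Category.assoc])

end GArr

/-- The horizontal arrows of `G(C)` from `P` to `Q`. -/
@[ext]
structure GHom (P Q : GObj C) : Type u where
  arr : GArr C
  src_eq : arr.src = P
  tgt_eq : arr.tgt = Q

theorem GArr.one_src (P : GObj C) : (GArr.one P).src = P := by
  obtain ⟨_, _, m, rfl⟩ := P.exists_rep; rfl

theorem GArr.one_tgt (P : GObj C) : (GArr.one P).tgt = P := by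
  obtain ⟨_, _, m, rfl⟩ := P.exists_rep; rfl

theorem GArr.inv_src (s : GArr C) : s.inv.src = s.tgt := by
  obtain ⟨_, _, _, l, r, rfl⟩ := s.exists_rep; rfl

theorem GArr.inv_tgt (s : GArr C) : s.inv.tgt = s.src := by
  obtain ⟨_, _, _, l, r, rfl⟩ := s.exists_rep; rfl

namespace GHom

/-- The identity arrow. -/
def id (P : GObj C) : GHom P P := ⟨GArr.one P, GArr.one_src P, GArr.one_tgt P⟩

/-- The inverse arrow. -/
def inv {P Q : GObj C} (f : GHom P Q) : GHom Q P :=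
  ⟨f.arr.inv, f.arr.inv_src.trans f.tgt_eq, f.arr.inv_tgt.trans f.src_eq⟩

theorem exists_comp {P Q R : GObj C} (f : GHom P Q) (g : GHom Q R) :
    ∃ u, GArr.Comp f.arr g.arr u := GArr.exists_comp (f.tgt_eq.trans g.src_eq.symm)

/-- The composite arrow, characterized by `GArr.Comp`. -/
noncomputable def comp {P Q R : GObj C} (f : GHom P Q) (g : GHom Q R) : GHom P R where
  arr := (exists_comp f g).choose
  src_eq := (exists_comp f g).choose_spec.src_eq.trans f.src_eq
  tgt_eq := (exists_comp f g).choose_spec.tgt_eq.trans g.tgt_eq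

theorem comp_spec {P Q R : GObj C} (f : GHom P Q) (g : GHom Q R) :
    GArr.Comp f.arr g.arr (comp f g).arr := (exists_comp f g).choose_spec

theorem sigma_ext {P Q P' Q' : GObj C} {f : GHom P Q} {g : GHom P' Q'} (h : f.arr = g.arr) :
    (⟨P, Q, f⟩ : Σ X Y : GObj C, GHom X Y) = ⟨P', Q', g⟩ := by
  obtain ⟨s, rfl, rfl⟩ := f
  obtain ⟨t, rfl, rfl⟩ := g
  obtain rfl : s = t := h
  rfl

theorem star_ext {P Q Q' : GObj C} {f : GHom P Q} {g : GHom P Q'} (h : f.arr = g.arr) :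
    (⟨Q, f⟩ : Σ Y : GObj C, GHom P Y) = ⟨Q', g⟩ := by
  obtain ⟨s, rfl, rfl⟩ := f
  obtain ⟨t, _, rfl⟩ := g
  obtain rfl : s = t := h
  rfl

variable [LeftCancellative C]

theorem comp_eq {P Q R : GObj C} {f : GHom P Q} {g : GHom Q R} {h : GHom P R}
    (e : GArr.Comp f.arr g.arr h.arr) : comp f g = h :=
  GHom.ext ((comp_spec f g).unique e)

theorem id_comp {P Q : GObj C} (f : GHom P Q) : comp (id P) f = f := by
  apply comp_eq
  obtain ⟨s, rfl, rfl⟩ := f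
  obtain ⟨_, _, _, l, r, rfl⟩ := s.exists_rep
  exact .mk l l r

theorem comp_id {P Q : GObj C} (f : GHom P Q) : comp f (id Q) = f := by
  apply comp_eq
  obtain ⟨s, rfl, rfl⟩ := f
  obtain ⟨_, _, _, l, r, rfl⟩ := s.exists_rep
  exact .mk l r r

theorem inv_comp {P Q : GObj C} (f : GHom P Q) : comp (inv f) f = id Q := by
  apply comp_eq
  obtain ⟨s, rfl, rfl⟩ := f
  obtain ⟨_, _, _, l, r, rfl⟩ := s.exists_rep
  exact .mk r l r

theorem comp_inv {P Q : GObj C} (f : GHom P Q) : comp f (inv f) = id P := by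
  apply comp_eq
  obtain ⟨s, rfl, rfl⟩ := f
  obtain ⟨_, _, _, l, r, rfl⟩ := s.exists_rep
  exact .mk l r l

theorem assoc {P Q R S : GObj C} (f : GHom P Q) (g : GHom Q R) (h : GHom R S) :
    comp (comp f g) h = comp f (comp g h) := by
  apply comp_eq
  have h₁ := comp_spec f g
  have h₂ := comp_spec g h
  have h₃ := comp_spec f (comp g h)
  revert h₁ h₂ h₃
  generalize (comp f (comp g h)).arr = x
  generalize (comp g h).arr = y
  generalize (comp f g).arr = z
  have hfg := f.tgt_eq.trans g.src_eq.symm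
  have hgh := g.tgt_eq.trans h.src_eq.symm
  obtain ⟨s, _, _⟩ := f
  obtain ⟨t, _, _⟩ := g
  obtain ⟨u, _, _⟩ := h
  dsimp only at *
  obtain ⟨_, _, _, l, r, rfl⟩ := s.exists_rep
  obtain ⟨_, n, rfl⟩ := GArr.exists_rep_of_src hfg.symm
  obtain ⟨_, p, rfl⟩ := GArr.exists_rep_of_src hgh.symm
  intro h₁ h₂ h₃
  obtain rfl := h₁.eq_mk
  obtain rfl := h₂.eq_mk
  obtain rfl := h₃.eq_mk
  exact .mk l n p

end GHom

variable [LeftCancellative C]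

noncomputable instance GObj.groupoid : Groupoid.{u} (GObj C) where
  Hom P Q := GHom P Q
  id P := GHom.id P
  comp f g := GHom.comp f g
  id_comp f := GHom.id_comp f
  comp_id f := GHom.comp_id f
  assoc f g h := GHom.assoc f g h
  inv f := GHom.inv f
  inv_comp f := GHom.inv_comp f
  comp_inv f := GHom.comp_inv f

/-- The ordered groupoid `G(C)`. -/
noncomputable instance GObj.orderedGroupoid : OrderedGroupoid (GObj C) where
  arrLE f g := GArr.LE (GHom.arr f) (GHom.arr g)
  arrLE_refl _ := .refl _
  arrLE_trans h k := h.trans k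
  arrLE_antisymm h k := GHom.sigma_ext (h.antisymm k)
  arrLE_inv h := h.inv
  arrLE_comp {_ _ _ _ _ _ f g f' g'} h k := h.comp k (GHom.comp_spec f g) (GHom.comp_spec f' g')
  existsUnique_restrict := by
    rintro _ _ P' ⟨s, rfl, rfl⟩ h
    obtain ⟨t, ⟨ht, hts⟩, hu⟩ := GArr.existsUnique_restrict (s := s) (P := P') h
    subst ht
    refine ⟨⟨t.tgt, ⟨t, rfl, rfl⟩⟩, hts, ?_⟩
    rintro ⟨Q, g⟩ hg
    exact GHom.star_ext (hu _ ⟨GHom.src_eq g, hg⟩)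

end GObj

/-! ### The 2-functor `G` -/

section GMap

variable {C D E : Type u} [Category.{u} C] [Category.{u} D] [Category.{u} E]

/-- The action `[m] ↦ [K m]` of a functor on subobjects. -/
def GObj.map (K : C ⥤ D) : GObj C → GObj D :=
  Quotient.lift (fun m => GObj.mk (K.map m.arr)) (by
    rintro _ _ ⟨k, m⟩
    exact GObj.sound (K.mapIso k) (by simp))

/-- The action `[l, r] ↦ [K l, K r]` of a functor on classes of spans. -/
def GArr.map (K : C ⥤ D) : GArr C → GArr D :=
  Quotient.lift (fun s => GArr.mk (K.map s.l) (K.map s.r)) (by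
    rintro _ _ ⟨k, l, r⟩
    exact GArr.sound (K.mapIso k) (by simp) (by simp))

/-- `[m] ↦ [K' m ∘ θ]`. -/
def GObj.mid {K K' : C ⥤ D} (θ : K ⟶ K') : GObj C → GObj D :=
  Quotient.lift (fun m => GObj.mk (θ.app m.dom ≫ K'.map m.arr)) (by
    rintro _ _ ⟨k, m⟩
    exact GObj.sound (K.mapIso k) (by simp))

/-- `[l, r] ↦ [K' l ∘ θ, K' r ∘ θ]`. -/
def GArr.mid {K K' : C ⥤ D} (θ : K ⟶ K') : GArr C → GArr D :=
  Quotient.lift (fun s => GArr.mk (θ.app s.apex ≫ K'.map s.l) (θ.app s.apex ≫ K'.map s.r)) (by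
    rintro _ _ ⟨k, l, r⟩
    exact GArr.sound (K.mapIso k) (by simp) (by simp))

/-- The arrow `[K m, K' m ∘ θ] : [K m] ⟶ [K' m ∘ θ]` assigned to `[m]`. -/
def GArr.comparison {K K' : C ⥤ D} (θ : K ⟶ K') : GObj C → GArr D :=
  Quotient.lift (fun m => GArr.mk (K.map m.arr) (θ.app m.dom ≫ K'.map m.arr)) (by
    rintro _ _ ⟨k, m⟩
    exact GArr.sound (K.mapIso k) (by simp) (by simp))

theorem GArr.Comp.map (K : C ⥤ D) {s t u : GArr C} (h : GArr.Comp s t u) :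
    GArr.Comp (GArr.map K s) (GArr.map K t) (GArr.map K u) := by
  obtain ⟨k, m, n⟩ := h
  exact .mk _ _ _

theorem GArr.Comp.mid {K K' : C ⥤ D} (θ : K ⟶ K') {s t u : GArr C} (h : GArr.Comp s t u) :
    GArr.Comp (GArr.mid θ s) (GArr.mid θ t) (GArr.mid θ u) := by
  obtain ⟨k, m, n⟩ := h
  exact .mk _ _ _

theorem GArr.LE.map (K : C ⥤ D) {s t : GArr C} (h : GArr.LE s t) :
    GArr.LE (GArr.map K s) (GArr.map K t) := by
  obtain ⟨k, l, r⟩ := h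
  exact .of_eq (K.map k) (by simp) (by simp)

theorem GArr.LE.mid {K K' : C ⥤ D} (θ : K ⟶ K') {s t : GArr C} (h : GArr.LE s t) :
    GArr.LE (GArr.mid θ s) (GArr.mid θ t) := by
  obtain ⟨k, l, r⟩ := h
  exact .of_eq (K.map k) (by simp) (by simp)

variable [LeftCancellative C] [LeftCancellative D] [LeftCancellative E]

/-- The ordered functor `G(K)`. -/
def GFunctor (K : C ⥤ D) : OrdFunctor (GObj C) (GObj D) where
  obj := GObj.map K
  map f := ⟨GArr.map K (GHom.arr f), by
      obtain ⟨s, rfl, rfl⟩ := f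
      obtain ⟨_, _, _, l, r, rfl⟩ := s.exists_rep
      rfl, by
      obtain ⟨s, rfl, rfl⟩ := f
      obtain ⟨_, _, _, l, r, rfl⟩ := s.exists_rep
      rfl⟩
  map_id P := GHom.ext (by
    obtain ⟨_, _, m, rfl⟩ := P.exists_rep
    rfl)
  map_comp f g := (GHom.comp_eq ((GHom.comp_spec f g).map K)).symm
  mono h := GArr.LE.map K h

/-- The middle functor `T` of `G(θ)`. -/
def GMid {K K' : C ⥤ D} (θ : K ⟶ K') : OrdFunctor (GObj C) (GObj D) where
  obj := GObj.mid θ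
  map f := ⟨GArr.mid θ (GHom.arr f), by
      obtain ⟨s, rfl, rfl⟩ := f
      obtain ⟨_, _, _, l, r, rfl⟩ := s.exists_rep
      rfl, by
      obtain ⟨s, rfl, rfl⟩ := f
      obtain ⟨_, _, _, l, r, rfl⟩ := s.exists_rep
      rfl⟩
  map_id P := GHom.ext (by
    obtain ⟨_, _, m, rfl⟩ := P.exists_rep
    rfl)
  map_comp f g := (GHom.comp_eq ((GHom.comp_spec f g).mid θ)).symm
  mono h := GArr.LE.mid θ h

/-- The `Λ`-transformation `G(θ) : G(K) ⇒ G(K')`, with components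
`[K m] ⟶ [K' m ∘ θ] ≤ [K' m]`. -/
def GTrans {K K' : C ⥤ D} (θ : K ⟶ K') : LambdaTrans (GFunctor K) (GFunctor K') where
  tgt := GMid θ
  arr :=
    { app := fun P => ⟨GArr.comparison θ P, by
        obtain ⟨_, _, m, rfl⟩ := P.exists_rep
        rfl, by
        obtain ⟨_, _, m, rfl⟩ := P.exists_rep
        rfl⟩
      naturality := by
        rintro _ _ ⟨s, rfl, rfl⟩
        obtain ⟨_, _, _, l, r, rfl⟩ := s.exists_rep
        exact (GHom.comp_eq (.mk _ (K.map r) _)).trans (GHom.comp_eq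
          (h := ⟨GArr.mk (K.map l) (θ.app _ ≫ K'.map r), rfl, rfl⟩) (.mk _ _ _)).symm
      mono := by
        intro P Q h
        change GArr.LE (GArr.one P) (GArr.one Q) at h
        obtain ⟨_, _, m, rfl⟩ := Q.exists_rep
        obtain ⟨_, k, hk⟩ := GArr.LE.exists_factor (l := m) (r := m) h
        have hP : P = GObj.mk (k ≫ m) := by
          rw [← GArr.one_src P, hk]
          rfl
        subst hP
        exact GArr.LE.of_eq (K.map k) (by simp) (by simp) }
  le := OrdFunctor.objLE_of_vle (by
    rintro _ _ ⟨s, rfl, rfl⟩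
    obtain ⟨_, _, _, l, r, rfl⟩ := s.exists_rep
    exact .mk (θ.app _) _ _)

/-- Ordered functors into `G(D)` agree when they agree on arrows. -/
theorem OrdFunctor.ext_arr {H : Type u} [OrderedGroupoid H] {F F' : OrdFunctor H (GObj D)}
    (h : ∀ {X Y : H} (f : X ⟶ Y), GHom.arr (F.map f) = GHom.arr (F'.map f)) : F = F' :=
  OrdFunctor.VLE.antisymm (fun f => (h f ▸ GArr.LE.refl _ : GArr.LE (GHom.arr _) _))
    (fun f => (h f ▸ GArr.LE.refl _ : GArr.LE _ (GHom.arr _)))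

/-- `Λ`-transformations between functors into `G(D)` agree when their components do. -/
theorem LambdaTrans.ext_arr {H : Type u} [OrderedGroupoid H] {F F' : OrdFunctor H (GObj D)}
    {α β : LambdaTrans F F'}
    (h : ∀ X, GHom.arr (α.app X).arr = GHom.arr (β.app X).arr) : α = β :=
  LambdaTrans.ext_app fun X => LHom.ext_star (GHom.star_ext (h X))

theorem GFunctor_id : GFunctor (𝟭 C) = OrdFunctor.id (GObj C) :=
  OrdFunctor.ext_arr (by
    rintro _ _ ⟨s, rfl, rfl⟩
    obtain ⟨_, _, _, l, r, rfl⟩ := s.exists_rep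
    rfl)

theorem GFunctor_comp (K : C ⥤ D) (M : D ⥤ E) :
    GFunctor (K ⋙ M) = (GFunctor K).comp (GFunctor M) :=
  OrdFunctor.ext_arr (by
    rintro _ _ ⟨s, rfl, rfl⟩
    obtain ⟨_, _, _, l, r, rfl⟩ := s.exists_rep
    rfl)

theorem GTrans_id (K : C ⥤ D) : GTrans (𝟙 K) = LHom.id (GFunctor K) :=
  LambdaTrans.ext_arr (fun P => by
    obtain ⟨_, _, m, rfl⟩ := P.exists_rep
    exact GArr.sound (Iso.refl _) (by simp) (by simp))

theorem GTrans_comp {K K' K'' : C ⥤ D} (θ : K ⟶ K') (θ' : K' ⟶ K'') :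
    GTrans (θ ≫ θ') = LHom.comp (GTrans θ) (GTrans θ') :=
  LambdaTrans.ext_app (fun P => by
    rw [LambdaTrans.comp_app]
    obtain ⟨_, _, m, rfl⟩ := P.exists_rep
    apply LHom.ext_star
    let k : GHom (GObj.mk (θ.app _ ≫ K'.map m)) (GObj.mk (θ.app _ ≫ θ'.app _ ≫ K''.map m)) :=
      ⟨GArr.mk _ _, rfl, rfl⟩
    refine Eq.trans ?_ (LHom.comp_star ((GTrans θ).app (GObj.mk m))
      ((GTrans θ').app (GObj.mk m)) k (GArr.LE.mk _ _ _)).symm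
    refine GHom.star_ext ?_
    refine Eq.trans ?_ (congrArg GHom.arr (GHom.comp_eq
      (h := ⟨GArr.mk (K.map m) (θ.app _ ≫ θ'.app _ ≫ K''.map m), rfl, rfl⟩)
      (GArr.Comp.mk _ _ _))).symm
    exact GArr.sound (Iso.refl _) (by simp) (by simp))

theorem GTrans_whiskerLeft (K : C ⥤ D) {M M' : D ⥤ E} (θ : M ⟶ M') (P : GObj C) :
    GHom.arr ((GTrans (Functor.whiskerLeft K θ)).app P).arr =
      GHom.arr ((LambdaTrans.whiskerLeft (GFunctor K) (GTrans θ)).app P).arr := by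
  obtain ⟨_, _, m, rfl⟩ := P.exists_rep
  rfl

theorem GTrans_whiskerRight {K K' : C ⥤ D} (θ : K ⟶ K') (M : D ⥤ E) (P : GObj C) :
    GHom.arr ((GTrans (Functor.whiskerRight θ M)).app P).arr =
      GHom.arr ((LambdaTrans.whiskerRight (GTrans θ) (GFunctor M)).app P).arr := by
  obtain ⟨_, _, m, rfl⟩ := P.exists_rep
  exact GArr.sound (Iso.refl _) (by simp) (by simp)

end GMap

theorem OGpd.eq_of_arr {𝒢 : OGpd.{u}} {D : Type u} [Category.{u} D] [LeftCancellative D]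
    {F₁ F₂ F₃ F₄ : 𝒢 ⟶ OGpd.mk (GObj D)} (e : F₁ = F₂) (α : F₂ ⟶ F₃) (e' : F₃ = F₄)
    (β : F₁ ⟶ F₄)
    (h : ∀ X : 𝒢.carrier, GHom.arr (LambdaTrans.app (G := 𝒢.carrier) (H := GObj D) β X).arr =
      GHom.arr (LambdaTrans.app (G := 𝒢.carrier) (H := GObj D) α X).arr) :
    β = eqToHom e ≫ α ≫ eqToHom e' := by
  subst e e'
  rw [← eq_eqToHom_comp]
  exact LambdaTrans.ext_arr h

open Bicategory in
/-- The 2-functor `G` from left-cancellative categories to ordered groupoids. -/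
noncomputable def lawsonG : StrictPseudofunctor LCCat.{u} OGpd.{u} :=
  StrictPseudofunctor.mk''
    { obj := fun C => OGpd.mk (GObj C.carrier)
      map := fun K => GFunctor (LCCat.functor K)
      map₂ := fun θ => GTrans (LCCat.natTrans θ)
      map₂_id := fun K => GTrans_id (LCCat.functor K)
      map₂_comp := fun θ θ' => GTrans_comp (LCCat.natTrans θ) (LCCat.natTrans θ')
      map_id := fun _ => GFunctor_id
      map_comp := fun K M => GFunctor_comp (LCCat.functor K) (LCCat.functor M)
      map₂_whisker_left := fun {A _ C} K M M' θ => OGpd.eq_of_arr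
        (𝒢 := OGpd.mk (GObj A.carrier)) (D := C.carrier)
        (GFunctor_comp (LCCat.functor K) (LCCat.functor M))
        (LambdaTrans.whiskerLeft (GFunctor (LCCat.functor K)) (GTrans (LCCat.natTrans θ)))
        (GFunctor_comp (LCCat.functor K) (LCCat.functor M')).symm
        (GTrans (Functor.whiskerLeft (LCCat.functor K) (LCCat.natTrans θ)))
        (GTrans_whiskerLeft (LCCat.functor K) (LCCat.natTrans θ))
      map₂_whisker_right := fun {A _ C K K'} θ M => OGpd.eq_of_arr
        (𝒢 := OGpd.mk (GObj A.carrier)) (D := C.carrier)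
        (GFunctor_comp (LCCat.functor K) (LCCat.functor M))
        (LambdaTrans.whiskerRight (GTrans (LCCat.natTrans θ)) (GFunctor (LCCat.functor M)))
        (GFunctor_comp (LCCat.functor K') (LCCat.functor M)).symm
        (GTrans (Functor.whiskerRight (LCCat.natTrans θ) (LCCat.functor M)))
        (GTrans_whiskerRight (LCCat.natTrans θ) (LCCat.functor M)) }

/-! ### Maximal objects -/

/-- An object is maximal if no other object lies above it. -/
def IsMaximalObj {G : Type u} [OrderedGroupoid G] (M : G) : Prop := ∀ A : G, ObjLE M A → A = M

/-- Each object lies below a unique maximal object. -/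
class HasMaximalObjects (G : Type u) [OrderedGroupoid G] : Prop where
  existsUnique_maximal : ∀ A : G, ∃! M : G, IsMaximalObj M ∧ ObjLE A M

instance GObj.hasMaximalObjects (C : Type u) [Category.{u} C] [LeftCancellative C] :
    HasMaximalObjects (GObj C) where
  existsUnique_maximal P := by
    have key : ∀ {A B : C} (m : A ⟶ B), ObjLE (GObj.mk m) (GObj.mk (𝟙 B)) := fun m =>
      GArr.LE.of_eq m (by simp) (by simp)
    obtain ⟨A, B, m, rfl⟩ := P.exists_rep
    refine ⟨GObj.mk (𝟙 B), ⟨?_, key m⟩, ?_⟩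
    · intro Q hQ
      obtain ⟨A', B', n, rfl⟩ := Q.exists_rep
      obtain ⟨_, k, hk⟩ := GArr.LE.exists_factor (l := n) (r := n) hQ
      have hk' : GObj.mk (𝟙 B) = GObj.mk (k ≫ n) := congrArg GArr.src hk
      obtain ⟨e, -⟩ := GObj.exact hk'
      subst e
      exact (key n).antisymm hQ
    · rintro Q ⟨hQ, hm⟩
      obtain ⟨A', B', n, rfl⟩ := Q.exists_rep
      obtain ⟨_, k, hk⟩ := GArr.LE.exists_factor (l := n) (r := n) hm
      have hk' : GObj.mk m = GObj.mk (k ≫ n) := congrArg GArr.src hk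
      obtain ⟨e, -⟩ := GObj.exact hk'
      subst e
      exact (hQ _ (key n)).symm

/-- The full sub-2-category of ordered groupoids in which each object lies below a unique maximal
object. -/
abbrev OGpdMax : Type (u + 1) :=
  Bicategory.InducedBicategory OGpd.{u}
    (fun 𝒢 : {𝒢 : OGpd.{u} // HasMaximalObjects 𝒢.carrier} => 𝒢.1)

namespace OGpdMax

/-- The type of objects of an object of `OGpdMax`. -/
abbrev carrier (𝒢 : OGpdMax.{u}) : Type u := 𝒢.1.carrier

/-- The object of `OGpdMax` given by a type with an ordered groupoid structure. -/
noncomputable def of (G : Type u) [OrderedGroupoid G] [h : HasMaximalObjects G] : OGpdMax.{u} := ⟨OGpd.mk G, h⟩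

/-- An ordered functor as a 1-cell. -/
noncomputable abbrev ofOrdFunctor {𝒢 ℋ : OGpdMax.{u}} (F : OrdFunctor 𝒢.carrier ℋ.carrier) : 𝒢 ⟶ ℋ :=
  Bicategory.InducedBicategory.mkHom F

end OGpdMax

/-- The restriction of `L` to `OGpdMax`. -/
noncomputable def lawsonLMax : StrictPseudofunctor OGpdMax.{u} LCCat.{u} :=
  Bicategory.InducedBicategory.forget.comp lawsonL

theorem OGpdMax.eq_of_hom {𝒢 ℋ : OGpdMax.{u}} {F₁ F₂ F₃ F₄ : 𝒢 ⟶ ℋ} (e : F₁ = F₂) (α : F₂ ⟶ F₃)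
    (e' : F₃ = F₄) (β : F₁ ⟶ F₄)
    (h : β.hom = eqToHom (congrArg Bicategory.InducedBicategory.Hom.hom e) ≫ α.hom ≫
      eqToHom (congrArg Bicategory.InducedBicategory.Hom.hom e')) :
    β = eqToHom e ≫ α ≫ eqToHom e' := by
  subst e e'
  rw [← eq_eqToHom_comp]
  exact Bicategory.InducedBicategory.hom₂_ext (by rw [h, ← eq_eqToHom_comp])

/-- The 2-functor `G` with values in `OGpdMax`. -/
noncomputable def lawsonGMax : StrictPseudofunctor LCCat.{u} OGpdMax.{u} :=
  StrictPseudofunctor.mk''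
    { obj := fun C => OGpdMax.of (GObj C.carrier)
      map := fun K => Bicategory.InducedBicategory.mkHom (lawsonG.map K)
      map₂ := fun θ => Bicategory.InducedBicategory.mkHom₂ (lawsonG.map₂ θ)
      map₂_id := fun K => Bicategory.InducedBicategory.hom₂_ext (lawsonG.map₂_id K)
      map₂_comp := fun θ θ' => Bicategory.InducedBicategory.hom₂_ext (lawsonG.map₂_comp θ θ')
      map_id := fun C => Bicategory.InducedBicategory.hom_ext (lawsonG.map_id C)
      map_comp := fun K M => Bicategory.InducedBicategory.hom_ext (lawsonG.map_comp K M)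
      map₂_whisker_left := fun K _ _ θ => OGpdMax.eq_of_hom _ _ _ _ (by
        refine (lawsonG.map₂_whisker_left K θ).trans ?_
        simp only [lawsonG.mapComp_eq_eqToIso]
        rfl)
      map₂_whisker_right := fun θ M => OGpdMax.eq_of_hom _ _ _ _ (by
        refine (lawsonG.map₂_whisker_right θ M).trans ?_
        simp only [lawsonG.mapComp_eq_eqToIso]
        rfl) }

/-! ### The unit and the counit -/

/-- The functor `η_C : C ⥤ LG(C)`: `A ↦ [1_A]` on objects, and `f : A ⟶ B` goes to
`[1_A, f] : [1_A] ⟶ [f] ≤ [1_B]`. -/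
noncomputable def etaFunctor (C : Type u) [Category.{u} C] [LeftCancellative C] :
    C ⥤ LObj (GObj C) where
  obj A := GObj.mk (𝟙 A)
  map {A B} f := LHom.mk (G := GObj C) (A := GObj.mk (𝟙 A)) (B := GObj.mk (𝟙 B)) (GObj.mk f)
    ⟨GArr.mk (𝟙 A) f, rfl, rfl⟩ (GArr.LE.of_eq f (by simp) (by simp))
  map_id A := rfl
  map_comp {X Y Z} f g := by
    apply LHom.ext_star
    let k : GHom (GObj.mk f) (GObj.mk (f ≫ g)) := ⟨GArr.mk f (f ≫ g), rfl, rfl⟩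
    refine Eq.trans ?_ (LHom.comp_star (G := GObj C) _ _ k
      (GArr.LE.of_eq f (by simp) (by simp))).symm
    exact GHom.star_ext (congrArg GHom.arr (GHom.comp_eq
      (h := ⟨GArr.mk (𝟙 X) (f ≫ g), rfl, rfl⟩) (GArr.Comp.mk _ _ _))).symm

section Kappa

variable {G : Type u} [OrderedGroupoid G]

theorem inv_comp_comp {A B D E : G} (k : A ⟶ B) (l : B ⟶ D) (r : B ⟶ E) :
    Groupoid.inv (k ≫ l) ≫ k ≫ r = Groupoid.inv l ≫ r := by simp

theorem inv_comp_inv_comp {A B D E : G} (l : A ⟶ B) (m : A ⟶ D) (n : A ⟶ E) :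
    (Groupoid.inv l ≫ m) ≫ Groupoid.inv m ≫ n = Groupoid.inv l ≫ n := by simp

/-- Isomorphisms in `L(G)` have a trivial vertical part. -/
theorem LHom.iso_hom {A A' : LObj G} (k : A ≅ A') :
    ∃ j : Quiver.Hom (V := G) A A', k.hom = LHom.mk (G := G) A' j (ObjLE.refl (G := G) A') := by
  have h : LHom.comp (G := G) k.inv k.hom = LHom.id (G := G) A' := k.inv_hom_id
  have h' : (LHom.comp (G := G) k.inv k.hom).tgt = A' := congrArg LHom.tgt h
  have h₁ : ObjLE (LHom.comp (G := G) k.inv k.hom).tgt (LHom.tgt k.hom) :=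
    objLE_tgt (res_le (LHom.arr k.hom) (LHom.le k.inv))
  have e : LHom.tgt k.hom = A' := (LHom.le k.hom).antisymm ((ObjLE.of_eq h'.symm).trans h₁)
  generalize k.hom = f at e
  obtain ⟨t, a, l⟩ := f
  dsimp at e
  subst e
  exact ⟨a, rfl⟩

theorem LHom.iso_comp {A A' B : G} (j : A ⟶ A') (m : LHom A' B) :
    LHom.comp ⟨A', j, ObjLE.refl A'⟩ m = ⟨m.tgt, j ≫ m.arr, m.le⟩ := by
  apply LHom.ext_star
  rw [LHom.comp_star _ m m.arr (arrLE_refl _)]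
  rfl

/-- `κ_G` on objects: `[A ⟶ B' ≤ B] ↦ B'`. -/
noncomputable def kappaObj : GObj (LObj G) → G :=
  Quotient.lift (fun m => LHom.tgt (G := G) m.arr) (by
    rintro _ _ ⟨k, m⟩
    obtain ⟨j, hj⟩ := LHom.iso_hom k
    exact (congrArg (fun k => LHom.tgt (LHom.comp (G := G) k m)) hj).trans
      (congrArg LHom.tgt (LHom.iso_comp j m)))

/-- `κ_G` on horizontal arrows: a span of `h : A ⟶ B' ≤ B` and `k : A ⟶ C' ≤ C` goes to
`k h⁻¹ : B' ⟶ C'`. -/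
noncomputable def kappaArr : GArr (LObj G) → Σ A B : G, A ⟶ B :=
  Quotient.lift (fun s => ⟨LHom.tgt (G := G) s.l, LHom.tgt (G := G) s.r,
      Groupoid.inv (LHom.arr (G := G) s.l) ≫ LHom.arr (G := G) s.r⟩) (by
    rintro _ _ ⟨k, l, r⟩
    obtain ⟨j, hj⟩ := LHom.iso_hom k
    have h₁ : k.hom ≫ l = _ :=
      (congrArg (fun k => LHom.comp (G := G) k l) hj).trans (LHom.iso_comp j l)
    have h₂ : k.hom ≫ r = _ :=
      (congrArg (fun k => LHom.comp (G := G) k r) hj).trans (LHom.iso_comp j r)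
    dsimp only
    rw [h₁, h₂]
    exact congrArg (fun f => (⟨LHom.tgt (G := G) l, LHom.tgt (G := G) r, f⟩ : Σ A B : G, A ⟶ B))
      (inv_comp_comp (G := G) j (LHom.arr l) (LHom.arr r)))

theorem kappaArr_src (s : GArr (LObj G)) : (kappaArr s).1 = kappaObj s.src := by
  obtain ⟨_, _, _, l, r, rfl⟩ := s.exists_rep; rfl

theorem kappaArr_tgt (s : GArr (LObj G)) : (kappaArr s).2.1 = kappaObj s.tgt := by
  obtain ⟨_, _, _, l, r, rfl⟩ := s.exists_rep; rfl

theorem kappaArr_mono {s t : GArr (LObj G)} (h : GArr.LE s t) :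
    arrLE (kappaArr s).2.2 (kappaArr t).2.2 := by
  obtain ⟨k, l, r⟩ := h
  change arrLE (Groupoid.inv (LHom.arr (LHom.comp (G := G) k l)) ≫
    LHom.arr (LHom.comp (G := G) k r)) (Groupoid.inv (LHom.arr l) ≫ LHom.arr r)
  have := arrLE_comp (arrLE_inv (res_le (LHom.arr l) (LHom.le k))) (res_le (LHom.arr r) (LHom.le k))
  rw [← inv_comp_comp (LHom.arr k)] at this
  exact this

theorem arrLE_cast {A B A' B' C D E F : G} {f : A ⟶ B} {g : C ⟶ D} (h : arrLE f g)
    (e₁ : A' = A) (e₂ : B = B') (e₃ : E = C) (e₄ : D = F) :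
    arrLE (eqToHom e₁ ≫ f ≫ eqToHom e₂) (eqToHom e₃ ≫ g ≫ eqToHom e₄) := by
  subst e₁ e₂ e₃ e₄
  simpa using h

/-- `κ_G` on the horizontal arrows from `P` to `Q`. -/
noncomputable def kappaMap {P Q : GObj (LObj G)} (f : GHom P Q) :
    Quiver.Hom (V := G) (kappaObj P) (kappaObj Q) :=
  eqToHom ((congrArg kappaObj f.src_eq.symm).trans (kappaArr_src f.arr).symm) ≫
    (kappaArr f.arr).2.2 ≫ eqToHom ((kappaArr_tgt f.arr).trans (congrArg kappaObj f.tgt_eq))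

theorem kappaMap_mk {A B D : LObj G} (l : A ⟶ B) (r : A ⟶ D) :
    kappaMap (⟨GArr.mk l r, rfl, rfl⟩ : GHom (GObj.mk l) (GObj.mk r)) =
      Groupoid.inv (LHom.arr (G := G) l) ≫ LHom.arr (G := G) r :=
  (Category.id_comp _).trans (Category.comp_id _)

/-- The ordered functor `κ_G : GL(G) ⟶ G`. -/
noncomputable def kappaFunctor (G : Type u) [OrderedGroupoid G] :
    OrdFunctor (GObj (LObj G)) G where
  obj := kappaObj
  map f := kappaMap f
  map_id P := by
    obtain ⟨_, _, m, rfl⟩ := P.exists_rep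
    exact (kappaMap_mk m m).trans (Groupoid.inv_comp _)
  map_comp {P Q R} f g := by
    obtain ⟨s, rfl, rfl⟩ := f
    obtain ⟨t, ht, rfl⟩ := g
    obtain ⟨_, _, _, l, m, rfl⟩ := s.exists_rep
    obtain ⟨_, n, rfl⟩ := GArr.exists_rep_of_src (l := m) ht
    have e : GHom.comp (⟨GArr.mk l m, rfl, rfl⟩ : GHom (GObj.mk l) (GObj.mk m))
        (⟨GArr.mk m n, rfl, rfl⟩ : GHom (GObj.mk m) (GObj.mk n)) =
        ⟨GArr.mk l n, rfl, rfl⟩ := GHom.comp_eq (GArr.Comp.mk l m n)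
    refine ((congrArg kappaMap e).trans (kappaMap_mk l n)).trans
      (Eq.trans ?_ (congrArg₂ (fun a b => a ≫ b) (kappaMap_mk l m) (kappaMap_mk m n)).symm)
    exact (inv_comp_inv_comp (G := G) _ _ _).symm
  mono h := arrLE_cast (kappaArr_mono h) _ _ _ _

end Kappa

/-! ### 2-adjunctions and biequivalences -/

section TwoAdjunction

open Bicategory

universe w₁ w₂ v₁ v₂ u₁ u₂

variable {B : Type u₁} [Bicategory.{w₁, v₁} B] {C : Type u₂} [Bicategory.{w₂, v₂} C]

/-- A strict 2-natural transformation between 2-functors. -/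
structure StrictTrans (F F' : StrictPseudofunctor B C) where
  app (a : B) : F.obj a ⟶ F'.obj a
  naturality {a b : B} (f : a ⟶ b) : F.map f ≫ app b = app a ≫ F'.map f
  naturality₂ {a b : B} {f g : a ⟶ b} (α : f ⟶ g) :
    F.map₂ α ▷ app b =
      eqToHom (naturality f) ≫ app a ◁ F'.map₂ α ≫ eqToHom (naturality g).symm

/-- A (strict) 2-adjunction `F ⊣ U`: 2-natural transformations `1 ⇒ UF` and `FU ⇒ 1` that satisfy
the triangle identities. -/
structure TwoAdjunction (F : StrictPseudofunctor B C) (U : StrictPseudofunctor C B) where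
  unit : StrictTrans (StrictPseudofunctor.id B) (F.comp U)
  counit : StrictTrans (U.comp F) (StrictPseudofunctor.id C)
  left_triangle (b : B) :
    F.map (unit.app b : b ⟶ U.obj (F.obj b)) ≫ (counit.app (F.obj b) : _ ⟶ F.obj b) =
      𝟙 (F.obj b)
  right_triangle (c : C) :
    (unit.app (U.obj c) : U.obj c ⟶ _) ≫ U.map (counit.app c : F.obj (U.obj c) ⟶ c) =
      𝟙 (U.obj c)

/-- A 1-cell is an equivalence if it has a pseudo-inverse. -/
def IsEquivalence₁ {a b : B} (f : a ⟶ b) : Prop := ∃ e : a ≌ b, e.hom = f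

/-- A 2-adjoint biequivalence: a 2-adjunction such that the components of the unit and of the
counit are equivalences. -/
structure TwoAdjointBiequivalence (F : StrictPseudofunctor B C) (U : StrictPseudofunctor C B)
    extends TwoAdjunction F U where
  unit_equivalence (b : B) : IsEquivalence₁ (unit.app b)
  counit_equivalence (c : C) : IsEquivalence₁ (counit.app c)

end TwoAdjunction

/-! Both constructions factor arrows in the same way. In `G(C)` an arrow `f : A ⟶ B` of `C` becomes
the invertible span `[1_A, f]` onto the subobject `[f]`, followed by the inequality `[f] ≤ [1_B]`.
In `L(G)` every arrow is by definition a horizontal isomorphism followed by an inequality.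

The unit is an equivalence because it is fully faithful and essentially surjective. A span with
source `[1_A]` has exactly one representative of the form `(1_A, f)`, and the condition `[f] ≤
[1_B]` forces `f` to end at `B`. Any subobject `[m : A ⟶ B]` is isomorphic to `[1_A]` through `[1_A,
m]`.

The counit forgets the ambient object `B` of a subobject `A ⟶ B' ≤ B`. A pseudo-inverse must choose
an ambient object for each object `A` of `G`, and the choice must be constant along the order, since
spans in `L(G)` are comparable only when they have the same feet. The unique maximal object above
`A` is such a choice: `A ≤ A'` implies `max A = max A'` (`maxObj_eq_of_le`). With `A ↦ [A ≤ max A]`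
(`maxFunctor`), following by the counit gives the identity on the nose. In the other order, `[h : A
⟶ B' ≤ B]` goes to `[B' ≤ max B']`, and the span with both legs carried by `h`, one into `B` and one
into `max B'`, is a horizontal transformation from the identity (`enlargeTrans`). Horizontal arrows
become invertible in `L`, so it is an invertible 2-cell.

Naturality and the triangle identities come down to `K 1 = 1`, to `F k (F h)⁻¹ = F (k h⁻¹)`, to
naturality of a horizontal transformation, and to `[1, r] ∘ [l, 1] = [l, r]`. These are strict
equalities between arrows whose endpoints agree only propositionally, so arrows are compared
together with their endpoints, as elements of a sigma type. -/

/-! ### Extensionality in terms of arrows with free endpoints -/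

/-- The horizontal part of an arrow of `L(G)`, together with its endpoints. -/
def LHom.sigma {G : Type u} [OrderedGroupoid G] {A B : G} (f : LHom A B) : Σ X Y : G, X ⟶ Y :=
  ⟨A, f.tgt, f.arr⟩

theorem LHom.ext_sigma {G : Type u} [OrderedGroupoid G] {A B : G} {f g : LHom A B}
    (h : f.sigma = g.sigma) : f = g :=
  LHom.ext_star (eq_of_heq (Sigma.mk.inj_iff.mp h).2)

/-- A class of spans determines its source and target, so over `G(C)` it is enough to compare span
classes. -/
theorem LHom.sigma_ext_arr {C : Type u} [Category.{u} C] [LeftCancellative C]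
    {A B A' B' : GObj C} {f : LHom A B} {g : LHom A' B'} (h : GHom.arr f.arr = GHom.arr g.arr) :
    f.sigma = g.sigma :=
  GHom.sigma_ext h

namespace OrderedGroupoid

variable {G : Type u} [OrderedGroupoid G]

theorem arrLE_of_sigma_eq {A B A' B' : G} {f : A ⟶ B} {g : A' ⟶ B'}
    (h : (⟨A, B, f⟩ : Σ X Y : G, X ⟶ Y) = ⟨A', B', g⟩) : arrLE f g := by
  cases h
  exact arrLE_refl f

theorem inv_id_comp {A B : G} (f : A ⟶ B) : Groupoid.inv (𝟙 A) ≫ f = f := by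
  simp

/-- Casts along equalities of objects disappear once the endpoints are part of the data. -/
theorem sigma_eqToHom {A B A' B' : G} (e : A' = A) (f : A ⟶ B) (e' : B = B') :
    (⟨A', B', eqToHom e ≫ f ≫ eqToHom e'⟩ : Σ X Y : G, X ⟶ Y) = ⟨A, B, f⟩ := by
  subst e e'
  simp

end OrderedGroupoid

/-- Antisymmetry of the order on ordered functors replaces any transport along equalities of
objects. -/
theorem OrdFunctor.ext_sigma {G H : Type u} [OrderedGroupoid G] [OrderedGroupoid H]
    {F F' : OrdFunctor G H}
    (h : ∀ {X Y : G} (f : X ⟶ Y), (⟨F.obj X, F.obj Y, F.map f⟩ : Σ X Y : H, X ⟶ Y) =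
      ⟨F'.obj X, F'.obj Y, F'.map f⟩) : F = F' :=
  OrdFunctor.VLE.antisymm (fun f => arrLE_of_sigma_eq (h f))
    (fun f => arrLE_of_sigma_eq (h f).symm)

/-- Functors into `L(G)` agree when they agree on arrows. -/
theorem LObj.functor_ext {C G : Type u} [Category.{u} C] [OrderedGroupoid G]
    {F F' : C ⥤ LObj G}
    (h : ∀ {X Y : C} (f : X ⟶ Y), LHom.sigma (G := G) (F.map f) = LHom.sigma (F'.map f)) :
    F = F' := by
  -- The values on objects are the sources of the images of identities.
  have ho : ∀ X, F.obj X = F'.obj X := fun X => congrArg Sigma.fst (h (𝟙 X))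
  obtain ⟨o, m, _, _⟩ := F
  obtain ⟨o', m', _, _⟩ := F'
  dsimp only at h ho
  obtain rfl : o = o' := funext ho
  obtain rfl : @m = @m' := by
    funext X Y f
    exact LHom.ext_sigma (h f)
  rfl

/-- This is the form of 2-dimensional strict naturality: replacing the 1-cells by equal ones turns
the casts into identities, and components with free endpoints do not see the replacement. -/
theorem LCCat.eq_of_sigma {C : LCCat.{u}} {G : Type u} [OrderedGroupoid G]
    {F₁ F₂ F₃ F₄ : C ⟶ LCCat.of (LObj G)} (e : F₁ = F₂) (α : F₂ ⟶ F₃) (e' : F₃ = F₄)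
    (β : F₁ ⟶ F₄)
    (h : ∀ X : C.carrier, LHom.sigma (G := G) ((natTrans β).app X) =
      LHom.sigma (G := G) ((natTrans α).app X)) :
    β = eqToHom e ≫ α ≫ eqToHom e' := by
  subst e e'
  rw [← eq_eqToHom_comp]
  exact LCCat.hom₂_ext fun X => LHom.ext_sigma (G := G) (h X)

theorem OGpd.eq_of_sigma {𝒢 ℋ : OGpd.{u}}
    {F₁ F₂ F₃ F₄ : 𝒢 ⟶ ℋ} (e : F₁ = F₂) (α : F₂ ⟶ F₃) (e' : F₃ = F₄) (β : F₁ ⟶ F₄)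
    (h : ∀ X : 𝒢.carrier, (LambdaTrans.app (G := 𝒢.carrier) (H := ℋ.carrier) β X).sigma =
      (LambdaTrans.app (G := 𝒢.carrier) (H := ℋ.carrier) α X).sigma) :
    β = eqToHom e ≫ α ≫ eqToHom e' := by
  subst e e'
  rw [← eq_eqToHom_comp]
  exact LambdaTrans.ext_app fun X => LHom.ext_sigma (h X)

/-! ### Naturality of the unit -/

section Eta

variable {C D : Type u} [Category.{u} C] [Category.{u} D] [LeftCancellative C] [LeftCancellative D]

/-- Both composites send `f : X ⟶ Y` to the span `[1, K f]`, because `K` preserves identities. -/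
theorem etaFunctor_naturality (K : C ⥤ D) :
    K ⋙ etaFunctor D = etaFunctor C ⋙ LFunctor (GFunctor K) :=
  LObj.functor_ext fun {X _} f => LHom.sigma_ext_arr (C := D)
    (show GArr.mk (𝟙 (K.obj X)) (K.map f) = GArr.mk (K.map (𝟙 X)) (K.map f) by rw [K.map_id])

theorem etaFunctor_naturality₂ {K K' : C ⥤ D} (θ : K ⟶ K') (X : C) :
    LHom.sigma (G := GObj D) ((etaFunctor D).map (θ.app X)) =
      ((GTrans θ).app ((etaFunctor C).obj X)).sigma :=
  LHom.sigma_ext_arr (C := D) (show GArr.mk (𝟙 (K.obj X)) (θ.app X) =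
    GArr.mk (K.map (𝟙 X)) (θ.app X ≫ K'.map (𝟙 X)) by simp)

/-- The 2-natural transformation `η : 1 ⇒ LG`. -/
noncomputable def etaTrans : StrictTrans (StrictPseudofunctor.id LCCat.{u})
    (lawsonGMax.comp lawsonLMax) where
  app C := LCCat.ofFunctor (etaFunctor C.carrier)
  naturality K := Bicategory.InducedBicategory.hom_ext
    (congrArg Functor.toCatHom (etaFunctor_naturality (LCCat.functor K)))
  naturality₂ {_ D _ _} θ := LCCat.eq_of_sigma (G := GObj D.carrier) _ _ _ _
    (etaFunctor_naturality₂ (LCCat.natTrans θ))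

end Eta

/-! ### Naturality of the counit -/

section KappaNat

variable {G H : Type u} [OrderedGroupoid G] [OrderedGroupoid H]

/-- Removes the casts in `kappaMap`, so that computations can be done on `kappaArr`, which reduces
on representatives. -/
theorem kappaFunctor_map_sigma {P Q : GObj (LObj G)} (f : P ⟶ Q) :
    (⟨(kappaFunctor G).obj P, (kappaFunctor G).obj Q, (kappaFunctor G).map f⟩ :
      Σ X Y : G, X ⟶ Y) = kappaArr (GHom.arr f) :=
  sigma_eqToHom _ _ _

theorem OrdFunctor.map_sigma_congr (F : OrdFunctor G H) {A B A' B' : G} {f : A ⟶ B} {g : A' ⟶ B'}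
    (h : (⟨A, B, f⟩ : Σ X Y : G, X ⟶ Y) = ⟨A', B', g⟩) :
    (⟨F.obj A, F.obj B, F.map f⟩ : Σ X Y : H, X ⟶ Y) = ⟨F.obj A', F.obj B', F.map g⟩ := by
  cases h
  rfl

theorem OrdFunctor.inv_map_comp_map (F : OrdFunctor G H) {A B D : G} (f : A ⟶ B) (g : A ⟶ D) :
    Groupoid.inv (F.map f) ≫ F.map g = F.map (Groupoid.inv f ≫ g) := by
  simp

/-- On a span `[l, r]` this is the fact that `F` preserves the quotient `r l⁻¹` of horizontal parts.
-/
theorem kappaFunctor_naturality (F : OrdFunctor G H) :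
    (GFunctor (LFunctor F)).comp (kappaFunctor H) = (kappaFunctor G).comp F :=
  OrdFunctor.ext_sigma fun {P Q} f => by
    refine (kappaFunctor_map_sigma ((GFunctor (LFunctor F)).map f)).trans
      (Eq.trans ?_ (F.map_sigma_congr (kappaFunctor_map_sigma f)).symm)
    obtain ⟨s, rfl, rfl⟩ := f
    obtain ⟨_, _, _, l, r, rfl⟩ := s.exists_rep
    refine congrArg (fun k => (⟨F.obj (LHom.tgt l), F.obj (LHom.tgt r), k⟩ :
      Σ X Y : H, X ⟶ Y)) ?_
    exact F.inv_map_comp_map (LHom.arr l) (LHom.arr r)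

/-- Write `α : F ⟶ F'' ≤ F'` and `m = (h : A ⟶ B', B' ≤ B)`. The left side at `[m]` is `F'' h ∘ α_A
∘ (F h)⁻¹`, which equals `α_{B'}` by naturality. -/
theorem kappaFunctor_naturality₂ {F F' : OrdFunctor G H} (α : LambdaTrans F F')
    (P : GObj (LObj G)) :
    (LHom.map (kappaFunctor H) ((GTrans (LNatTrans α)).app P)).sigma =
      (α.app ((kappaFunctor G).obj P)).sigma := by
  refine (kappaFunctor_map_sigma ((GTrans (LNatTrans α)).app P).arr).trans ?_
  obtain ⟨A, B, m, rfl⟩ := P.exists_rep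
  change (⟨_, _, Groupoid.inv (F.map (LHom.arr m)) ≫
    LHom.arr (LHom.comp (α.app A) (LHom.map F' m))⟩ : Σ X Y : H, X ⟶ Y) = _
  -- Since `F'' ≤ F'`, the restriction of `F' h` to `F'' A` is `F'' h`.
  have h := LHom.comp_star (α.app A) (LHom.map F' m) _ (OrdFunctor.vle_of_objLE α.le (LHom.arr m))
  refine (congrArg (fun s : (Σ Y : H, F.obj A ⟶ Y) => (⟨_, s.1,
    Groupoid.inv (F.map (LHom.arr m)) ≫ s.2⟩ : Σ X Y : H, X ⟶ Y)) h).trans ?_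
  refine congrArg (fun k => (⟨F.obj (LHom.tgt m), α.tgt.obj (LHom.tgt m), k⟩ :
      Σ X Y : H, X ⟶ Y)) ?_
  have := α.arr.naturality (LHom.arr m)
  change Groupoid.inv (F.map (LHom.arr m)) ≫ α.arr.app A ≫ α.tgt.map (LHom.arr m) = _
  rw [← this]
  simp
  rfl

/-- The 2-natural transformation `κ : GL ⇒ 1`. -/
noncomputable def kappaTrans : StrictTrans (lawsonLMax.comp lawsonGMax)
    (StrictPseudofunctor.id OGpdMax.{u}) where
  app 𝒢 := OGpdMax.ofOrdFunctor (kappaFunctor 𝒢.carrier)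
  naturality F := Bicategory.InducedBicategory.hom_ext (kappaFunctor_naturality F.hom)
  naturality₂ {𝒢 ℋ _ _} α := OGpdMax.eq_of_hom _ _ _ _ (OGpd.eq_of_sigma _ _ _ _
    (kappaFunctor_naturality₂ (G := 𝒢.carrier) (H := ℋ.carrier) α.hom))

end KappaNat

/-! ### The triangle identities -/

/-- The span `[η l, η r]` is sent to `[1, r] ∘ [1, l]⁻¹ = [1, r] ∘ [l, 1] = [l, r]`. -/
theorem GFunctor_eta_comp_kappa (C : Type u) [Category.{u} C] [LeftCancellative C] :
    (GFunctor (etaFunctor C)).comp (kappaFunctor (GObj C)) = OrdFunctor.id (GObj C) :=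
  OrdFunctor.ext_sigma fun {P Q} f => by
    refine (kappaFunctor_map_sigma ((GFunctor (etaFunctor C)).map f)).trans ?_
    obtain ⟨s, rfl, rfl⟩ := f
    obtain ⟨_, _, _, l, r, rfl⟩ := s.exists_rep
    exact GHom.sigma_ext (congrArg GHom.arr (GHom.comp_eq
      (h := (⟨GArr.mk l r, rfl, rfl⟩ : GHom (GObj.mk l) (GObj.mk r))) (GArr.Comp.mk l (𝟙 _) r)))

/-- The unit turns `f` into the span `[1, f]`, and the counit returns the horizontal part of `f`
divided by an identity. The vertical part carries no further information. -/
theorem eta_comp_LFunctor_kappa (G : Type u) [OrderedGroupoid G] :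
    etaFunctor (LObj G) ⋙ LFunctor (kappaFunctor G) = 𝟭 (LObj G) :=
  LObj.functor_ext fun {A B} f => by
    refine (kappaFunctor_map_sigma (LHom.arr ((etaFunctor (LObj G)).map f))).trans ?_
    refine congrArg (fun k => (⟨A, LHom.tgt f, k⟩ : Σ X Y : G, X ⟶ Y)) ?_
    exact inv_id_comp (LHom.arr f)

/-- The 2-adjunction between `G` and `L`. -/
noncomputable def lawsonAdjunction : TwoAdjunction lawsonGMax.{u} lawsonLMax.{u} where
  unit := etaTrans
  counit := kappaTrans
  left_triangle C := Bicategory.InducedBicategory.hom_ext (GFunctor_eta_comp_kappa C.carrier)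
  right_triangle 𝒢 := Bicategory.InducedBicategory.hom_ext
    (congrArg Functor.toCatHom (eta_comp_LFunctor_kappa 𝒢.carrier))

/-! ### The components of the unit are equivalences -/

/-- No triangle identity is required of the two isomorphisms: one of them can be corrected to make
the equivalence adjoint. -/
theorem isEquivalence₁_of_iso {B : Type*} [Bicategory B] {a b : B} {f : a ⟶ b} {g : b ⟶ a}
    (η : 𝟙 a ≅ f ≫ g) (ε : g ≫ f ≅ 𝟙 b) : IsEquivalence₁ f :=
  ⟨Bicategory.Equivalence.mkOfAdjointifyCounit η ε, rfl⟩

/-- A natural isomorphism as an invertible 2-cell. -/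
def LCCat.ofNatIso {C D : LCCat.{u}} {F F' : C ⟶ D} (φ : functor F ≅ functor F') : F ≅ F' where
  hom := ofNatTrans φ.hom
  inv := ofNatTrans φ.inv
  hom_inv_id := hom₂_ext fun X => φ.hom_inv_id_app X
  inv_hom_id := hom₂_ext fun X => φ.inv_hom_id_app X

theorem LCCat.isEquivalence₁_ofFunctor {C D : LCCat.{u}} (F : C.carrier ⥤ D.carrier)
    (_ : F.IsEquivalence) : IsEquivalence₁ (LCCat.ofFunctor F) :=
  isEquivalence₁_of_iso (g := LCCat.ofFunctor F.inv)
    (LCCat.ofNatIso F.asEquivalence.unitIso) (LCCat.ofNatIso F.asEquivalence.counitIso)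

/-- A horizontal arrow of `G` as an isomorphism of `L(G)`. -/
def LObj.isoOfHom {G : Type u} [OrderedGroupoid G] {A B : G} (f : A ⟶ B) :
    @Iso (LObj G) _ A B where
  hom := LHom.mk B f (ObjLE.refl B)
  inv := LHom.mk A (Groupoid.inv f) (ObjLE.refl A)
  hom_inv_id := (LHom.iso_comp f _).trans (LHom.ext_star (by simp only [LHom.star, Groupoid.comp_inv]; rfl))
  inv_hom_id := (LHom.iso_comp (Groupoid.inv f) _).trans
    (LHom.ext_star (by simp only [LHom.star, Groupoid.inv_comp]; rfl))

section Eta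

variable {C : Type u} [Category.{u} C] [LeftCancellative C]

instance etaFunctor_faithful : (etaFunctor C).Faithful where
  map_injective {A B f g} h := by
    have h' : GArr.mk (𝟙 A) f = GArr.mk (𝟙 A) g :=
      congrArg (fun s : (Σ X Y : GObj C, GHom X Y) => s.2.2.arr)
        (congrArg (LHom.sigma (G := GObj C)) h)
    -- The isomorphism relating the two representatives must fix the left leg `1_A`, so it is the
    -- identity.
    obtain ⟨_, _, k, h₁, h₂⟩ := GArr.exact h'
    simp only [eqToHom_refl, Category.comp_id] at h₁ h₂
    rw [← h₂, h₁, Category.id_comp]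

instance etaFunctor_full : (etaFunctor C).Full where
  map_surjective {A B} := by
    intro ⟨P, ⟨s, hs, ht⟩, h⟩
    subst ht
    -- The source `[1_A]` allows a representative with left leg `1_A`; its right leg is the
    -- preimage, up to its codomain.
    obtain ⟨D, f, rfl⟩ := GArr.exists_rep_of_src (l := 𝟙 A) hs
    have h' : GArr.LE (GArr.mk f f) (GArr.mk (𝟙 B) (𝟙 B)) := h
    -- Spans below `[1_B, 1_B]` have feet `B`, which identifies the codomain `D` of `f` with `B`.
    obtain ⟨_, k, hk⟩ := h'.exists_factor
    obtain ⟨e, -⟩ := GArr.exact hk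
    subst e
    exact ⟨f, rfl⟩

instance etaFunctor_essSurj : (etaFunctor C).EssSurj where
  mem_essImage P := by
    obtain ⟨A, B, m, rfl⟩ := GObj.exists_rep (C := C) P
    exact ⟨A, ⟨LObj.isoOfHom (G := GObj C)
      (⟨GArr.mk (𝟙 A) m, rfl, rfl⟩ : GHom (GObj.mk (𝟙 A)) (GObj.mk m))⟩⟩

instance etaFunctor_isEquivalence : (etaFunctor C).IsEquivalence where

end Eta

/-! ### The components of the counit are equivalences -/

section LObj

variable {G : Type u} [OrderedGroupoid G]

/-- An arrow `A ⟶ B` of `G` followed by `B ≤ D`, as an arrow of `L(G)`. -/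
def LHom.ofHom {A B D : G} (f : A ⟶ B) (h : ObjLE B D) :
    Quiver.Hom (V := LObj G) A D :=
  LHom.mk B f h

theorem comp_inv_comp {A B D : G} (f : A ⟶ B) (g : A ⟶ D) : f ≫ Groupoid.inv f ≫ g = g := by
  simp

theorem LHom.isoOfHom_comp_ofHom {A A' B D : G} (j : A ⟶ A') (f : A' ⟶ B) (h : ObjLE B D) :
    (LObj.isoOfHom j).hom ≫ LHom.ofHom (G := G) f h = LHom.ofHom (G := G) (j ≫ f) h :=
  LHom.iso_comp j _

theorem LHom.isoOfHom_comp_ofHom_id {A B D : G} (f : A ⟶ B) (h : ObjLE B D) :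
    (LObj.isoOfHom f).hom ≫ LHom.ofHom (G := G) (𝟙 B) h = LHom.ofHom (G := G) f h :=
  (LHom.isoOfHom_comp_ofHom f (𝟙 B) h).trans (by rw [Category.comp_id])

/-- Composing `A ≤ D` with `g` restricts `g` to `A`, and `f ≤ g` says that this restriction is `f`.
-/
theorem LHom.ofHom_comp {A B D E M : G} {f : A ⟶ B} {g : D ⟶ E} (hAD : ObjLE A D)
    (h : arrLE f g) (hB : ObjLE B M) (hE : ObjLE E M) :
    LHom.ofHom (G := G) (𝟙 A) hAD ≫ LHom.ofHom (G := G) g hE = LHom.ofHom (G := G) f hB := by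
  refine LHom.ext_star ((LHom.comp_star (LHom.mk A (𝟙 A) hAD) (LHom.mk E g hE) f h).trans ?_)
  rw [Category.id_comp]
  rfl

/-- The inequality `A ≤ D`, seen as an arrow of `L(G)`, is the common factor. The feet must coincide
for the spans to be comparable, hence the equalities `M = M'` and `N = N'`; for maximal objects they
hold automatically. -/
theorem GArr.le_ofHom {A B D E M M' N N' : G} {f : A ⟶ B} {g : D ⟶ E} (h : arrLE f g)
    (hM : M = M') (hN : N = N') (hA : ObjLE A M) (hB : ObjLE B N) (hD : ObjLE D M')
    (hE : ObjLE E N') :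
    GArr.LE (GArr.mk (LHom.ofHom (G := G) (𝟙 A) hA) (LHom.ofHom (G := G) f hB))
      (GArr.mk (LHom.ofHom (G := G) (𝟙 D) hD) (LHom.ofHom (G := G) g hE)) := by
  subst hM hN
  exact GArr.LE.of_eq _ (LHom.ofHom_comp (objLE_src h) (objLE_src h) hA hD)
    (LHom.ofHom_comp (objLE_src h) h hB hE)

/-- The common factor is `k` itself: changing the ambient object of `m` does not change the
horizontal part of `k ≫ m`. -/
theorem GArr.le_enlarge {A B D : LObj G} (k : A ⟶ B) (m : B ⟶ D) {M M' : G} (hM : M = M')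
    (h : ObjLE (LHom.tgt (G := G) (k ≫ m)) M) (h' : ObjLE (LHom.tgt (G := G) m) M') :
    GArr.LE (GArr.mk (k ≫ m) (LHom.ofHom (G := G) (LHom.arr (G := G) (k ≫ m)) h))
      (GArr.mk m (LHom.ofHom (G := G) (LHom.arr (G := G) m) h')) := by
  subst hM
  exact GArr.LE.of_eq k rfl rfl

end LObj

/-! ### Maximal objects and the pseudo-inverse of the counit -/

section Sigma

variable {G : Type u} [OrderedGroupoid G] [HasMaximalObjects G]

/-- The maximal object above a given one. -/
noncomputable def maxObj (A : G) : G := (HasMaximalObjects.existsUnique_maximal A).choose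

theorem isMaximalObj_maxObj (A : G) : IsMaximalObj (maxObj A) :=
  (HasMaximalObjects.existsUnique_maximal A).choose_spec.1.1

theorem le_maxObj (A : G) : ObjLE A (maxObj A) :=
  (HasMaximalObjects.existsUnique_maximal A).choose_spec.1.2

/-- `max B` is also a maximal object above `A`. This is where uniqueness of maximal objects is used.
-/
theorem maxObj_eq_of_le {A B : G} (h : ObjLE A B) : maxObj A = maxObj B :=
  (HasMaximalObjects.existsUnique_maximal A).unique ⟨isMaximalObj_maxObj A, le_maxObj A⟩
    ⟨isMaximalObj_maxObj B, h.trans (le_maxObj B)⟩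

/-- The span `[A ≤ max A, A ⟶ B ≤ max B]` of an arrow `A ⟶ B`. -/
noncomputable def maxArr {A B : G} (f : A ⟶ B) : GArr (LObj G) :=
  GArr.mk (LHom.ofHom (G := G) (𝟙 A) (le_maxObj A)) (LHom.ofHom (G := G) f (le_maxObj B))

/-- Moving the apex along the isomorphism `f` makes the left leg of `maxArr g` equal to the right
leg of `maxArr f`, the form in which spans compose. -/
theorem maxArr_eq {A B D : G} (f : A ⟶ B) (g : B ⟶ D) :
    maxArr g = GArr.mk (LHom.ofHom (G := G) f (le_maxObj B)) (LHom.ofHom (G := G) (f ≫ g) (le_maxObj D)) :=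
  (GArr.sound (LObj.isoOfHom f) (LHom.isoOfHom_comp_ofHom_id f _)
    (LHom.isoOfHom_comp_ofHom f g _)).symm

variable (G) in
/-- The pseudo-inverse `G ⟶ GL(G)` of `κ_G`, which sends `A` to `[A ≤ max A]`. -/
noncomputable def maxFunctor : OrdFunctor G (GObj (LObj G)) where
  obj A := GObj.mk (LHom.ofHom (G := G) (𝟙 A) (le_maxObj A))
  map f := ⟨maxArr f, rfl, GObj.sound (LObj.isoOfHom (G := G) f) (LHom.isoOfHom_comp_ofHom_id f _)⟩
  map_id _ := rfl
  map_comp f g := (GHom.comp_eq (by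
    dsimp only
    rw [maxArr_eq f g]
    exact .mk _ _ _)).symm
  mono h := GArr.le_ofHom h (maxObj_eq_of_le (objLE_src h)) (maxObj_eq_of_le (objLE_tgt h)) _ _ _ _

theorem maxFunctor_comp_kappa : (maxFunctor G).comp (kappaFunctor G) = OrdFunctor.id G :=
  OrdFunctor.ext_sigma fun {A B} f =>
    (kappaFunctor_map_sigma ((maxFunctor G).map f)).trans
      (congrArg (fun k => (⟨A, B, k⟩ : Σ X Y : G, X ⟶ Y)) (inv_id_comp f))

/-- The span `[m, n]` where `m` is an arrow `A ⟶ B' ≤ B` and `n` is `A ⟶ B' ≤ max B'`. -/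
noncomputable def enlargeRep {A B : LObj G} (m : A ⟶ B) : GArr (LObj G) :=
  GArr.mk m (LHom.ofHom (G := G) (LHom.arr (G := G) m) (le_maxObj (LHom.tgt (G := G) m)))

/-- The arrow `[A ⟶ B' ≤ B] ⟶ [B' ≤ max B']` of `GL(G)`. -/
noncomputable def enlarge : GObj (LObj G) → GArr (LObj G) :=
  Quotient.lift (fun m => enlargeRep m.arr) (by
    rintro _ _ ⟨k, m⟩
    obtain ⟨j, hj⟩ := LHom.iso_hom k
    have h : k.hom ≫ m = LHom.mk (LHom.tgt (G := G) m) (j ≫ LHom.arr (G := G) m) (LHom.le (G := G) m) :=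
      (congrArg (fun k => LHom.comp (G := G) k m) hj).trans (LHom.iso_comp j m)
    -- The isomorphism `k` relates both legs at once, since precomposing with it leaves the object
    -- `B'`, and so `max B'`, unchanged.
    refine (congrArg enlargeRep h).trans (GArr.sound k h ?_)
    exact (congrArg (fun k => LHom.comp (G := G) k _) hj).trans (LHom.iso_comp j _))

theorem enlarge_src (P : GObj (LObj G)) : (enlarge P).src = P := by
  obtain ⟨_, _, m, rfl⟩ := P.exists_rep
  rfl

/-- The right leg `A ⟶ B' ≤ max B'` differs from `B' ≤ max B'` only by its horizontal part, an
isomorphism of `L(G)`. -/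
theorem enlarge_tgt (P : GObj (LObj G)) :
    (enlarge P).tgt = (maxFunctor G).obj ((kappaFunctor G).obj P) := by
  obtain ⟨_, _, m, rfl⟩ := P.exists_rep
  exact GObj.sound (LObj.isoOfHom (G := G) (LHom.arr (G := G) m)) (LHom.isoOfHom_comp_ofHom_id (LHom.arr (G := G) m) _)

/-- The apex is moved from the target of `l` back to `A` along `l`, which cancels the inverse in `r
l⁻¹`. -/
theorem maxArr_kappaMap {A B D : LObj G} (l : A ⟶ B) (r : A ⟶ D) :
    maxArr (kappaMap (⟨GArr.mk l r, rfl, rfl⟩ : GHom (GObj.mk l) (GObj.mk r))) =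
      GArr.mk (LHom.ofHom (G := G) (LHom.arr (G := G) l) (le_maxObj (LHom.tgt (G := G) l)))
        (LHom.ofHom (G := G) (LHom.arr (G := G) r) (le_maxObj (LHom.tgt (G := G) r))) := by
  refine (congrArg maxArr (kappaMap_mk l r)).trans ((maxArr_eq (LHom.arr (G := G) l) _).trans ?_)
  refine congrArg (fun k => GArr.mk (LHom.ofHom (G := G) (LHom.arr (G := G) l) (le_maxObj (LHom.tgt (G := G) l)))
        (LHom.ofHom (G := G) k (le_maxObj (LHom.tgt (G := G) r)))) ?_
  exact comp_inv_comp (LHom.arr (G := G) l) _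

variable (G) in
/-- The horizontal transformation from the identity of `GL(G)` to `κ_G` followed by its
pseudo-inverse. -/
noncomputable def enlargeTrans :
    OrdFunctor.HTrans (OrdFunctor.id (GObj (LObj G))) ((kappaFunctor G).comp (maxFunctor G)) where
  app P := ⟨enlarge P, enlarge_src P, enlarge_tgt P⟩
  naturality := by
    rintro _ _ ⟨s, rfl, rfl⟩
    obtain ⟨_, _, _, l, r, rfl⟩ := s.exists_rep
    let n := LHom.ofHom (G := G) (LHom.arr (G := G) r) (le_maxObj (LHom.tgt (G := G) r))
    -- Both ways around the naturality square give the span `[l, n]`.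
    refine (GHom.comp_eq (h := ⟨GArr.mk l n, rfl, enlarge_tgt (GObj.mk r)⟩) (.mk l r n)).trans
      (GHom.comp_eq ?_).symm
    change GArr.Comp (GArr.mk l (LHom.ofHom (G := G) (LHom.arr (G := G) l) (le_maxObj _)))
      (maxArr (kappaMap (⟨GArr.mk l r, rfl, rfl⟩ : GHom (GObj.mk l) (GObj.mk r)))) (GArr.mk l n)
    rw [maxArr_kappaMap]
    exact .mk _ _ _
  mono := by
    intro P Q h
    change GArr.LE (GArr.one P) (GArr.one Q) at h
    obtain ⟨_, _, m, rfl⟩ := Q.exists_rep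
    obtain ⟨_, k, hk⟩ := GArr.LE.exists_factor (l := m) (r := m) h
    have hP : P = GObj.mk (k ≫ m) := by
      rw [← GArr.one_src P, hk]
      rfl
    subst hP
    -- The horizontal target of `k ≫ m` lies below that of `m`, so both have the same maximal object
    -- above them.
    exact GArr.le_enlarge k m
      (maxObj_eq_of_le (objLE_tgt (res_le (LHom.arr (G := G) m) (LHom.le (G := G) k)))) _ _

end Sigma

theorem kappa_isEquivalence₁ (𝒢 : OGpdMax.{u}) :
    IsEquivalence₁ (OGpdMax.ofOrdFunctor (𝒢 := OGpdMax.of (GObj (LObj 𝒢.carrier))) (ℋ := 𝒢)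
      (kappaFunctor 𝒢.carrier)) :=
  haveI : HasMaximalObjects 𝒢.carrier := 𝒢.2
  isEquivalence₁_of_iso
    (g := OGpdMax.ofOrdFunctor (𝒢 := 𝒢) (ℋ := OGpdMax.of (GObj (LObj 𝒢.carrier)))
      (maxFunctor 𝒢.carrier))
    -- `enlargeTrans` is an arrow of the ordered groupoid of ordered functors, hence an isomorphism
    -- in the hom-category, which is `L` of that groupoid.
    (Bicategory.InducedBicategory.isoMk
      (LObj.isoOfHom (G := OrdFunctor _ _) (enlargeTrans 𝒢.carrier)))
    (eqToIso (Bicategory.InducedBicategory.hom_ext maxFunctor_comp_kappa))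

/-- The 2-adjoint biequivalence between `G` and `L`. -/
noncomputable def lawsonBiequivalence :
    TwoAdjointBiequivalence lawsonGMax.{u} lawsonLMax.{u} where
  toTwoAdjunction := lawsonAdjunction
  unit_equivalence C := LCCat.isEquivalence₁_ofFunctor
    (D := LCCat.of (LObj (GObj C.carrier))) (etaFunctor C.carrier) etaFunctor_isEquivalence
  counit_equivalence 𝒢 := kappa_isEquivalence₁ 𝒢

theorem mainTheorem2 :
    ∃ E : TwoAdjointBiequivalence lawsonGMax.{u} lawsonLMax.{u},
      (∀ C : LCCat.{u}, E.unit.app C = LCCat.ofFunctor (etaFunctor C.carrier)) ∧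
      (∀ 𝒢 : OGpdMax.{u}, E.counit.app 𝒢 = OGpdMax.ofOrdFunctor (kappaFunctor 𝒢.carrier)) :=
  ⟨lawsonBiequivalence, fun _ => rfl, fun _ => rfl⟩
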